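/- Let $\sigma>0$ and $\alpha_1,\alpha_2>0$. Consider the channel $Y=X+Z$, where $Z\sim\mathcal N(0,\sigma^2)$ is independent of the input $X$, and let $$C(\alpha_1,\alpha_2,A)=\sup_{P_X} I(X;Y)\quad\text{(in nats)},$$ the supremum being over all laws $P_X$ with $X\in[0,A]$ almost surely, $E[X]\le\alpha_1A$ and $E[X^2]\le\alpha_2A^2$. This capacity is finite for every $A>0$. Put $$\zeta_0(\lambda_1,\lambda_2)=\int_0^1 e^{-\lambda_1y-\lambda_2y^2}\,dy,\qquad \Gamma(\lambda_1,\lambda_2)=\log\zeta_0(\lambda_1,\lambda_2)+\lambda_1\alpha_1+\lambda_2\alpha_2,\qquad Q(x)=\frac1{\sqrt{2\pi}}\int_x^\infty e^{-t^2/2}\,dt .$$ Call the first-moment constraint inactive if $C(1,\alpha_2,A)-C(\alpha_1,\alpha_2,A)\to0$ as $A\to\infty$, the second-moment constraint inactive if $C(\alpha_1,1,A)-C(\alpha_1,\alpha_2,A)\to0$ as $A\to\infty$, and a constraint active if it is not inactive. (For $X\in[0,A]$ a moment constraint with parameter $1$ is void.) The function $\Gamma$ is strictly convex on $\mathbb R^2$,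 and $$\lim_{A\to\infty}\Bigl(C(\alpha_1,\alpha_2,A)-\log\frac{A}{\sqrt{2\pi e\sigma^2}}\Bigr)=\log\zeta_0(\lambda_1^*,\lambda_2^*)+\lambda_1^*\alpha_1+\lambda_2^*\alpha_2,$$ where $(\lambda_1^*,\lambda_2^*)$ is the unique minimizer of $\Gamma$ over $[0,\infty)^2$, which is determined as follows. 1. If $\alpha_1\ge\frac12$ and $\alpha_2\ge\frac13$, then both constraints are inactive, $\lambda_1^*=\lambda_2^*=0$, and the limit is $0$. 2. If $\alpha_1<\frac12$, the equation $$\frac1{\lambda_1}-\frac{e^{-\lambda_1}}{1-e^{-\lambda_1}}=\alpha_1\qquad(\lambda_1\ne0)$$ has a unique solution $\lambda_1^*$, and $\lambda_1^*>0$. If moreover $$\frac2{(\lambda_1^*)^2}-\frac{e^{-\lambda_1^*}\bigl(1+\frac2{\lambda_1^*}\bigr)}{1-e^{-\lambda_1^*}}\le\alpha_2,$$ then only the first-moment constraint is active, $\lambda_2^*=0$, and the limit is $\log\zeta_0(\lambda_1^*,0)+\lambda_1^*\alpha_1$. 3. If $\alpha_2<\frac13$, the equation $$2\sqrt{\pi\lambda_2}\,\bigl((2\lambda_2)^{-1}-\alpha_2\bigr)\Bigl[\tfrac12-Q\bigl(\sqrt{2\lambda_2}\bigr)\Bigr]=e^{-\lambda_2}\qquad(\lambda_2>0)$$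 has a unique solution $\lambda_2^*$. If moreover $$2\sqrt{\pi\lambda_2^*}\,\alpha_1\Bigl[\tfrac12-Q\bigl(\sqrt{2\lambda_2^*}\bigr)\Bigr]\ge1-e^{-\lambda_2^*},$$ then only the second-moment constraint is active, $\lambda_1^*=0$, and the limit is $\log\zeta_0(0,\lambda_2^*)+\lambda_2^*\alpha_2$. 4. In all other cases both constraints are active, and $(\lambda_1^*,\lambda_2^*)$ is the unique solution with $\lambda_1,\lambda_2>0$ of the two equations $$\sqrt{\pi\lambda_2}\,e^{\frac{\lambda_1^2}{4\lambda_2}}\Bigl(2\alpha_1+\frac{\lambda_1}{\lambda_2}\Bigr)\Bigl[Q\Bigl(\frac{\lambda_1}{\sqrt{2\lambda_2}}\Bigr)-Q\Bigl(\frac{\lambda_1+2\lambda_2}{\sqrt{2\lambda_2}}\Bigr)\Bigr]=1-e^{-(\lambda_1+\lambda_2)},$$ $$\sqrt{\frac{\pi}{\lambda_2}}\,e^{\frac{\lambda_1^2}{4\lambda_2}}\Bigl(\alpha_2-\frac{2\lambda_2+\lambda_1^2}{4\lambda_2^2}\Bigr)\Bigl[Q\Bigl(\frac{\lambda_1}{\sqrt{2\lambda_2}}\Bigr)-Q\Bigl(\frac{\lambda_1+2\lambda_2}{\sqrt{2\lambda_2}}\Bigr)\Bigr]=\frac1{2\lambda_2}e^{-(\lambda_1+\lambda_2)}\Bigl(\frac{\lambda_1}{2\lambda_2}-1\Bigr)-\frac{\lambda_1}{4\lambda_2^2}.$$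 -/

import Mathlib

open MeasureTheory ProbabilityTheory Filter Topology Set
open scoped NNReal ENNReal

noncomputable section

namespace MomentChannel

/-- The joint law of `(X, Y)`, where `X` has law `P`, `Y = X + Z`, and `Z` is a centred Gaussian
of variance `σ ^ 2` independent of `X`. -/
def jointLaw (σ : ℝ) (P : Measure ℝ) : Measure (ℝ × ℝ) :=
  (P.prod (gaussianReal 0 ⟨σ ^ 2, sq_nonneg σ⟩)).map (fun q : ℝ × ℝ => (q.1, q.1 + q.2))

/-- The mutual information, in nats, of a pair with joint law `γ`: the Kullback-Leibler divergence
of the joint law from the product of its marginals. -/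
def mutualInfo (γ : Measure (ℝ × ℝ)) : ℝ≥0∞ :=
  InformationTheory.klDiv γ (γ.fst.prod γ.snd)

/-- The admissible input laws: `X ∈ [0, A]` almost surely, `E[X] ≤ α₁ A`, `E[X ^ 2] ≤ α₂ A ^ 2`. -/
structure Admissible (α₁ α₂ A : ℝ) (P : Measure ℝ) : Prop where
  isProbabilityMeasure : IsProbabilityMeasure P
  peak : ∀ᵐ x ∂P, x ∈ Icc 0 A
  first_moment : ∫ x, x ∂P ≤ α₁ * A
  second_moment : ∫ x, x ^ 2 ∂P ≤ α₂ * A ^ 2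

/-- The capacity `C(α₁, α₂, A)` in nats, for noise variance `σ ^ 2`. -/
def capacity (σ α₁ α₂ A : ℝ) : ℝ≥0∞ :=
  ⨆ (P : Measure ℝ) (_ : Admissible α₁ α₂ A P), mutualInfo (jointLaw σ P)

/-- `C(α₁, α₂, A) - log (A / √(2 π e σ ^ 2))` tends to `L` as `A → ∞`. -/
def HasHighSNRLimit (σ α₁ α₂ L : ℝ) : Prop :=
  Tendsto (fun A : ℝ => (capacity σ α₁ α₂ A).toReal
      - Real.log (A / √(2 * Real.pi * Real.exp 1 * σ ^ 2)))
    atTop (𝓝 L)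

/-- The first-moment constraint is asymptotically inactive: removing it leaves the capacity
unchanged up to a term that vanishes as `A → ∞`. (For inputs in `[0, A]` the constraint with
`α₁ = 1` is void.) The constraint is active if it is not inactive. -/
def FirstMomentInactive (σ α₁ α₂ : ℝ) : Prop :=
  Tendsto (fun A : ℝ => (capacity σ 1 α₂ A).toReal - (capacity σ α₁ α₂ A).toReal) atTop (𝓝 0)

/-- The second-moment constraint is asymptotically inactive: removing it leaves the capacity
unchanged up to a term that vanishes as `A → ∞`. (For inputs in `[0, A]` the constraint with
`α₂ = 1` is void.) The constraint is active if it is not inactive. -/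
def SecondMomentInactive (σ α₁ α₂ : ℝ) : Prop :=
  Tendsto (fun A : ℝ => (capacity σ α₁ 1 A).toReal - (capacity σ α₁ α₂ A).toReal) atTop (𝓝 0)

/-- `ζ₀(l₁, l₂) = ∫₀¹ exp (-l₁ y - l₂ y ^ 2) dy`. -/
def zeta₀ (l₁ l₂ : ℝ) : ℝ :=
  ∫ y in (0 : ℝ)..1, Real.exp (-l₁ * y - l₂ * y ^ 2)

/-- The dual function `Γ(l₁, l₂) = log ζ₀(l₁, l₂) + l₁ α₁ + l₂ α₂`. -/
def Gam (α₁ α₂ : ℝ) (l : ℝ × ℝ) : ℝ :=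
  Real.log (zeta₀ l.1 l.2) + l.1 * α₁ + l.2 * α₂

/-- `l` is the unique minimizer of `Γ` over the closed quadrant `[0, ∞) × [0, ∞)`. -/
def IsUniqueMinimizer (α₁ α₂ : ℝ) (l : ℝ × ℝ) : Prop :=
  0 ≤ l.1 ∧ 0 ≤ l.2 ∧
    ∀ m : ℝ × ℝ, 0 ≤ m.1 → 0 ≤ m.2 → m ≠ l → Gam α₁ α₂ l < Gam α₁ α₂ m

/-- The Gaussian tail function `Q`. -/
def Q (x : ℝ) : ℝ :=
  (√(2 * Real.pi))⁻¹ * ∫ t in Ioi x, Real.exp (-t ^ 2 / 2)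

/-- The equation for the multiplier when the first-moment constraint is met with equality and the
second multiplier is zero. -/
def FirstEq (α₁ l : ℝ) : Prop :=
  1 / l - Real.exp (-l) / (1 - Real.exp (-l)) = α₁

/-- The second-moment constraint holds at the multiplier pair `(l, 0)`. -/
def FirstSlack (α₂ l : ℝ) : Prop :=
  2 / l ^ 2 - Real.exp (-l) * (1 + 2 / l) / (1 - Real.exp (-l)) ≤ α₂

/-- The equation for the multiplier when the second-moment constraint is met with equality and the
first multiplier is zero. -/
def SecondEq (α₂ l : ℝ) : Prop :=
  2 * √(Real.pi * l) * ((2 * l)⁻¹ - α₂) * (1 / 2 - Q √(2 * l)) = Real.exp (-l)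

/-- The first-moment constraint holds at the multiplier pair `(0, l)`. -/
def SecondSlack (α₁ l : ℝ) : Prop :=
  1 - Real.exp (-l) ≤ 2 * √(Real.pi * l) * α₁ * (1 / 2 - Q √(2 * l))

/-- The pair of equations for the multipliers when both constraints are met with equality. -/
def BothEq (α₁ α₂ l₁ l₂ : ℝ) : Prop :=
  √(Real.pi * l₂) * Real.exp (l₁ ^ 2 / (4 * l₂)) * (2 * α₁ + l₁ / l₂)
      * (Q (l₁ / √(2 * l₂)) - Q ((l₁ + 2 * l₂) / √(2 * l₂)))
    = 1 - Real.exp (-(l₁ + l₂)) ∧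
  √(Real.pi / l₂) * Real.exp (l₁ ^ 2 / (4 * l₂)) * (α₂ - (2 * l₂ + l₁ ^ 2) / (4 * l₂ ^ 2))
      * (Q (l₁ / √(2 * l₂)) - Q ((l₁ + 2 * l₂) / √(2 * l₂)))
    = 1 / (2 * l₂) * Real.exp (-(l₁ + l₂)) * (l₁ / (2 * l₂) - 1) - l₁ / (4 * l₂ ^ 2)

end MomentChannel

end

/-! The capacity is squeezed between two bounds that share a multiplier pair `l`.

Upper bound: mutual information is at most the divergence of the joint law from `P × R` for any
output law `R`. Take `R` with density in `u = y / A` proportional to `exp (-l₁ u - l₂ u ^ 2 - A d(u)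
^ 2)`, `d` being the distance to `[0, 1]`. For `l ≥ 0` the moment constraints turn the first two
terms into `l₁ α₁ + l₂ α₂`, the penalty costs at most `σ ^ 2 / A`, and the normalizer tends to
`ζ₀(l)`; so the excess over the logarithm is asymptotically at most `Γ(l)` (`mutualInfo_le`,
`tendsto_refNorm`).

Lower bound: feed in the law on `[0, A]` with scaled density `exp (-l₁ u - l₂ u ^ 2) / ζ₀(l)`. A
pointwise bound on its output density (`output_density_le`), used as a Donsker-Varadhan test
function, gives asymptotically `log ζ₀ + l₁ mean 1 l + l₂ mean 2 l`.

Under the conditions `KKT`, this input is admissible and complementary slackness makes the two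
limits equal (`KKT.hasHighSNRLimit`). Such an `l` exists because `Γ` is coercive on the quadrant,
and it is the unique minimizer because `Γ` lies strictly above its tangent planes (`Gam_gt`). The
four cases record which coordinates of `l` vanish. The explicit equations say `mean k l = αₖ`,
rewritten through integration by parts and the Gaussian integral. Activity is decided by comparing
the limits with and without a constraint. -/

noncomputable section

namespace MomentChannel

/-! ### Truncated moments of the exponential family -/

/-- The unnormalized `k`-th moment of the density `exp (-l₁ y - l₂ y ^ 2)` on `[0, 1]`. -/
def mom (k : ℕ) (l : ℝ × ℝ) : ℝ :=
  ∫ y in (0 : ℝ)..1, y ^ k * Real.exp (-l.1 * y - l.2 * y ^ 2)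

/-- The `k`-th moment of the law on `[0, 1]` with density proportional to
`exp (-l₁ y - l₂ y ^ 2)`. -/
def mean (k : ℕ) (l : ℝ × ℝ) : ℝ := mom k l / zeta₀ l.1 l.2

theorem mom_zero (l : ℝ × ℝ) : mom 0 l = zeta₀ l.1 l.2 := by
  simp [mom, zeta₀]

theorem continuous_mom (k : ℕ) : Continuous (mom k) := by
  unfold mom
  apply intervalIntegral.continuous_parametric_intervalIntegral_of_continuous'
  fun_prop

theorem zeta₀_pos (a b : ℝ) : 0 < zeta₀ a b := by
  unfold zeta₀
  apply intervalIntegral.intervalIntegral_pos_of_pos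
  · apply Continuous.intervalIntegrable; fun_prop
  · intro x; positivity
  · norm_num

theorem continuous_zeta₀ : Continuous fun l : ℝ × ℝ => zeta₀ l.1 l.2 := by
  simpa only [← mom_zero] using continuous_mom 0

theorem continuous_mean (k : ℕ) : Continuous (mean k) :=
  (continuous_mom k).div continuous_zeta₀ fun _ => (zeta₀_pos _ _).ne'

theorem continuous_Gam (α₁ α₂ : ℝ) : Continuous (Gam α₁ α₂) := by
  unfold Gam
  refine ((continuous_zeta₀.log fun _ => (zeta₀_pos _ _).ne').add ?_).add ?_ <;> fun_prop

theorem mean_mul_zeta₀ (k : ℕ) (l : ℝ × ℝ) : mean k l * zeta₀ l.1 l.2 = mom k l :=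
  div_mul_cancel₀ _ (zeta₀_pos _ _).ne'

theorem mom_succ_lt (k : ℕ) (l : ℝ × ℝ) : mom (k + 1) l < mom k l := by
  unfold mom
  apply intervalIntegral.integral_lt_integral_of_continuousOn_of_le_of_exists_lt
  · norm_num
  · fun_prop
  · fun_prop
  · intro y hy
    gcongr ?_ * _
    exact pow_le_pow_of_le_one hy.1.le hy.2 (Nat.le_succ k)
  · refine ⟨1 / 2, by norm_num, ?_⟩
    gcongr ?_ * _
    exact pow_lt_pow_right_of_lt_one₀ (by norm_num) (by norm_num) (Nat.lt_succ_self k)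

theorem mean_one_lt_one (l : ℝ × ℝ) : mean 1 l < 1 := by
  rw [mean, div_lt_one (zeta₀_pos _ _), ← mom_zero]
  exact mom_succ_lt 0 l

theorem mean_two_lt_one (l : ℝ × ℝ) : mean 2 l < 1 := by
  rw [mean, div_lt_one (zeta₀_pos _ _), ← mom_zero]
  exact (mom_succ_lt 1 l).trans (mom_succ_lt 0 l)

/-- The strict supporting plane of `log ζ₀`. -/
theorem log_zeta₀_gt {l m : ℝ × ℝ} (h : m ≠ l) :
    Real.log (zeta₀ l.1 l.2) - (m.1 - l.1) * mean 1 l - (m.2 - l.2) * mean 2 l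
      < Real.log (zeta₀ m.1 m.2) := by
  set c := (m.1 - l.1) * mean 1 l + (m.2 - l.2) * mean 2 l with hc
  -- Up to the constant `c`, `s` is the log-ratio of the weights of `m` and `l`; `c` centres it
  -- under the law of `l`, so that `∫ (s + 1) w = ζ₀(l)` and `1 + s ≤ exp s` yields the tangent
  -- plane.
  let s : ℝ → ℝ := fun y => c - (m.1 - l.1) * y - (m.2 - l.2) * y ^ 2
  let w : ℝ → ℝ := fun y => Real.exp (-l.1 * y - l.2 * y ^ 2)
  have hlt : ∫ y in (0 : ℝ)..1, (s y + 1) * w y < ∫ y in (0 : ℝ)..1, Real.exp (s y) * w y := by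
    apply intervalIntegral.integral_lt_integral_of_continuousOn_of_le_of_exists_lt
    · norm_num
    · fun_prop
    · fun_prop
    · intro y _
      exact mul_le_mul_of_nonneg_right (Real.add_one_le_exp _) (Real.exp_pos _).le
    -- A polynomial of degree at most two vanishing at `0`, `1 / 2` and `1` is zero, which would
    -- force `m = l`.
    · have key : ∃ y ∈ Icc (0 : ℝ) 1, s y ≠ 0 := by
        by_contra! hs
        have h0 := hs 0 (by norm_num)
        have h1 := hs 1 (by norm_num)
        have h2 := hs (1 / 2) (by norm_num)
        simp only [s] at h0 h1 h2
        apply h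
        ext <;> linarith
      obtain ⟨y, hy, hs⟩ := key
      exact ⟨y, hy, mul_lt_mul_of_pos_right (Real.add_one_lt_exp hs) (Real.exp_pos _)⟩
  have e1 : ∫ y in (0 : ℝ)..1, (s y + 1) * w y = zeta₀ l.1 l.2 := by
    have : ∀ y, (s y + 1) * w y
        = (c + 1) * w y - (m.1 - l.1) * (y ^ 1 * w y) - (m.2 - l.2) * (y ^ 2 * w y) := by
      intro y; simp only [s]; ring
    simp_rw [this]
    rw [intervalIntegral.integral_sub, intervalIntegral.integral_sub,
      intervalIntegral.integral_const_mul, intervalIntegral.integral_const_mul,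
      intervalIntegral.integral_const_mul]
    · change (c + 1) * zeta₀ l.1 l.2 - (m.1 - l.1) * mom 1 l - (m.2 - l.2) * mom 2 l = _
      rw [← mean_mul_zeta₀, ← mean_mul_zeta₀, hc]
      ring
    all_goals apply Continuous.intervalIntegrable; fun_prop
  have e2 : ∫ y in (0 : ℝ)..1, Real.exp (s y) * w y = Real.exp c * zeta₀ m.1 m.2 := by
    rw [zeta₀, ← intervalIntegral.integral_const_mul]
    congr 1; ext y
    simp only [s, w]
    rw [← Real.exp_add, ← Real.exp_add]
    ring_nf
  rw [e1, e2] at hlt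
  have := Real.log_lt_log (zeta₀_pos _ _) hlt
  rw [Real.log_mul (Real.exp_pos _).ne' (zeta₀_pos _ _).ne', Real.log_exp] at this
  linarith

/-- The gradient of `Γ` is `(α₁ - mean 1, α₂ - mean 2)`. This tangent-plane inequality replaces
differentiation: strict convexity and both directions of the KKT argument rest on it. -/
theorem Gam_gt (α₁ α₂ : ℝ) {l m : ℝ × ℝ} (h : m ≠ l) :
    Gam α₁ α₂ l + (m.1 - l.1) * (α₁ - mean 1 l) + (m.2 - l.2) * (α₂ - mean 2 l)
      < Gam α₁ α₂ m := by
  have := log_zeta₀_gt h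
  unfold Gam
  linarith

theorem strictConvexOn_Gam (α₁ α₂ : ℝ) : StrictConvexOn ℝ univ (Gam α₁ α₂) := by
  refine ⟨convex_univ, fun x _ y _ hxy a b ha hb hab => ?_⟩
  obtain rfl : b = 1 - a := by linarith
  have hx : x ≠ a • x + (1 - a) • y := by
    intro h
    apply hxy
    have : (1 - a) • (x - y) = 0 := by
      calc (1 - a) • (x - y) = x - (a • x + (1 - a) • y) := by module
        _ = 0 := sub_eq_zero.2 h
    exact sub_eq_zero.1 ((smul_eq_zero.1 this).resolve_left hb.ne')
  have hy : y ≠ a • x + (1 - a) • y := by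
    intro h
    apply hxy
    have : a • (x - y) = 0 := by
      calc a • (x - y) = (a • x + (1 - a) • y) - y := by module
        _ = 0 := sub_eq_zero.2 h.symm
    exact sub_eq_zero.1 ((smul_eq_zero.1 this).resolve_left ha.ne')
  have h1 := mul_lt_mul_of_pos_left (Gam_gt α₁ α₂ hx) ha
  have h2 := mul_lt_mul_of_pos_left (Gam_gt α₁ α₂ hy) hb
  refine lt_of_eq_of_lt ?_ (add_lt_add h1 h2)
  simp only [Prod.fst_add, Prod.snd_add, Prod.smul_fst, Prod.smul_snd, smul_eq_mul]
  ring

/-- Sum of the strict tangent-plane inequalities at `l` and at `m`. It yields uniqueness in all the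
multiplier equations. -/
theorem mean_strictAnti {l m : ℝ × ℝ} (h : m ≠ l) :
    (m.1 - l.1) * (mean 1 m - mean 1 l) + (m.2 - l.2) * (mean 2 m - mean 2 l) < 0 := by
  have h1 := log_zeta₀_gt h
  have h2 := log_zeta₀_gt h.symm
  linarith

theorem eq_of_mean_eq {l m : ℝ × ℝ} (h1 : mean 1 m = mean 1 l) (h2 : mean 2 m = mean 2 l) :
    m = l := by
  by_contra h
  have := mean_strictAnti h
  simp [h1, h2] at this

/-! ### The constrained minimizer -/

/-- The Karush-Kuhn-Tucker conditions for the minimization of `Γ` over the closed quadrant. -/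
structure KKT (α₁ α₂ : ℝ) (l : ℝ × ℝ) : Prop where
  fst_nonneg : 0 ≤ l.1
  snd_nonneg : 0 ≤ l.2
  mean_one_le : mean 1 l ≤ α₁
  mean_two_le : mean 2 l ≤ α₂
  fst_slack : l.1 * (α₁ - mean 1 l) = 0
  snd_slack : l.2 * (α₂ - mean 2 l) = 0

theorem KKT.isUniqueMinimizer {α₁ α₂ : ℝ} {l : ℝ × ℝ} (h : KKT α₁ α₂ l) :
    IsUniqueMinimizer α₁ α₂ l := by
  refine ⟨h.fst_nonneg, h.snd_nonneg, fun m hm1 hm2 hm => ?_⟩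
  have := Gam_gt α₁ α₂ hm
  have e1 := mul_nonneg hm1 (sub_nonneg.2 h.mean_one_le)
  have e2 := mul_nonneg hm2 (sub_nonneg.2 h.mean_two_le)
  linarith [h.fst_slack, h.snd_slack]

/-- Coercivity: on `[0, ε]` both `y` and `y ^ 2` are at most `ε`, so `log ζ₀` loses at most `ε (l₁ +
l₂)` beyond a constant, and half of each linear term survives. -/
theorem Gam_ge_linear {α₁ α₂ ε : ℝ} (hε : 0 < ε) (hε1 : ε ≤ 1) (h1 : ε ≤ α₁ / 2)
    (h2 : ε ≤ α₂ / 2) {l : ℝ × ℝ} (hl1 : 0 ≤ l.1) (hl2 : 0 ≤ l.2) :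
    Real.log ε + l.1 * (α₁ / 2) + l.2 * (α₂ / 2) ≤ Gam α₁ α₂ l := by
  have hz : ε * Real.exp (-l.1 * ε - l.2 * ε) ≤ zeta₀ l.1 l.2 := by
    calc ε * Real.exp (-l.1 * ε - l.2 * ε)
        = ∫ y in (0 : ℝ)..ε, Real.exp (-l.1 * ε - l.2 * ε) := by simp
      _ ≤ ∫ y in (0 : ℝ)..ε, Real.exp (-l.1 * y - l.2 * y ^ 2) := by
          apply intervalIntegral.integral_mono_on hε.le
          · simp
          · apply Continuous.intervalIntegrable; fun_prop
          · intro y hy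
            apply Real.exp_le_exp.2
            have e1 := mul_le_mul_of_nonneg_left hy.2 hl1
            have e2 : l.2 * y ^ 2 ≤ l.2 * ε :=
              mul_le_mul_of_nonneg_left (by nlinarith [hy.1, hy.2]) hl2
            linarith
      _ ≤ zeta₀ l.1 l.2 := by
          apply intervalIntegral.integral_mono_interval le_rfl hε.le hε1
          · exact ae_of_all _ fun y => (Real.exp_pos _).le
          · apply Continuous.intervalIntegrable; fun_prop
  have := Real.log_le_log (by positivity) hz
  rw [Real.log_mul hε.ne' (Real.exp_pos _).ne', Real.log_exp] at this
  unfold Gam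
  have e1 := mul_le_mul_of_nonneg_left h1 hl1
  have e2 := mul_le_mul_of_nonneg_left h2 hl2
  linarith

theorem exists_minimizer {α₁ α₂ : ℝ} (hα₁ : 0 < α₁) (hα₂ : 0 < α₂) :
    ∃ l : ℝ × ℝ, 0 ≤ l.1 ∧ 0 ≤ l.2 ∧
      ∀ m : ℝ × ℝ, 0 ≤ m.1 → 0 ≤ m.2 → Gam α₁ α₂ l ≤ Gam α₁ α₂ m := by
  set ε := min 1 (min (α₁ / 2) (α₂ / 2)) with hεdef
  have hε : 0 < ε := by positivity
  have hε0 : ε ≤ 1 := min_le_left _ _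
  have hε1 : ε ≤ α₁ / 2 := (min_le_right _ _).trans (min_le_left _ _)
  have hε2 : ε ≤ α₂ / 2 := (min_le_right _ _).trans (min_le_right _ _)
  -- Outside the box `[0, R]²` the linear lower bound, whose slopes are at least `ε`, already
  -- reaches `Γ(0)`.
  set R := max 0 ((Gam α₁ α₂ 0 - Real.log ε) / ε) with hR
  have hR0 : 0 ≤ R := le_max_left _ _
  have hRε : Gam α₁ α₂ 0 - Real.log ε ≤ R * ε := (div_le_iff₀ hε).1 (le_max_right _ _)
  obtain ⟨l, hl, hmin⟩ := (isCompact_Icc (a := ((0 : ℝ), (0 : ℝ))) (b := (R, R))).exists_isMinOn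
    ⟨0, by simp [Prod.le_def, hR0]⟩ (continuous_Gam α₁ α₂).continuousOn
  refine ⟨l, hl.1.1, hl.1.2, fun m hm1 hm2 => ?_⟩
  have h0 : Gam α₁ α₂ l ≤ Gam α₁ α₂ 0 := hmin (by simp [Prod.le_def, hR0])
  by_cases hm : m.1 ≤ R ∧ m.2 ≤ R
  · exact hmin ⟨⟨hm1, hm2⟩, hm⟩
  · refine h0.trans (le_trans ?_ (Gam_ge_linear hε hε0 hε1 hε2 hm1 hm2))
    have a1 := mul_le_mul_of_nonneg_left hε1 hm1
    have a2 := mul_le_mul_of_nonneg_left hε2 hm2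
    have a3 := mul_nonneg hm1 hε.le
    have a4 := mul_nonneg hm2 hε.le
    rcases not_and_or.1 hm with h | h
    · have := mul_le_mul_of_nonneg_right (not_le.1 h).le hε.le
      linarith
    · have := mul_le_mul_of_nonneg_right (not_le.1 h).le hε.le
      linarith

theorem exists_KKT {α₁ α₂ : ℝ} (hα₁ : 0 < α₁) (hα₂ : 0 < α₂) :
    ∃ l : ℝ × ℝ, KKT α₁ α₂ l := by
  obtain ⟨l, hl1, hl2, hmin⟩ := exists_minimizer hα₁ hα₂
  -- The tangent plane is taken at `l + t` and evaluated at the minimizer `l`. Dividing by `t` along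
  -- an axis and letting `t → 0` gives the first-order conditions from continuity of `mean` alone.
  have key : ∀ t : ℝ × ℝ, t ≠ 0 → 0 ≤ l.1 + t.1 → 0 ≤ l.2 + t.2 →
      0 < t.1 * (α₁ - mean 1 (l + t)) + t.2 * (α₂ - mean 2 (l + t)) := by
    intro t ht h1 h2
    have a := hmin (l + t) h1 h2
    have b := Gam_gt α₁ α₂ (l := l + t) (m := l) (by simpa using ht)
    simp only [Prod.fst_add, Prod.snd_add] at b
    linarith
  have cont1 : Continuous fun t : ℝ => mean 1 (l + (t, 0)) :=
    (continuous_mean 1).comp (by fun_prop)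
  have cont2 : Continuous fun t : ℝ => mean 2 (l + (0, t)) :=
    (continuous_mean 2).comp (by fun_prop)
  have l0 : l + ((0 : ℝ), (0 : ℝ)) = l := add_zero l
  have lim1 : Tendsto (fun t : ℝ => mean 1 (l + (t, 0))) (𝓝 0) (𝓝 (mean 1 l)) := by
    simpa only [l0] using cont1.tendsto 0
  have lim2 : Tendsto (fun t : ℝ => mean 2 (l + (0, t))) (𝓝 0) (𝓝 (mean 2 l)) := by
    simpa only [l0] using cont2.tendsto 0
  have le1 : mean 1 l ≤ α₁ := by
    refine le_of_tendsto (lim1.mono_left (nhdsWithin_le_nhds (s := Ioi 0))) ?_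
    filter_upwards [self_mem_nhdsWithin] with t (ht : 0 < t)
    have := key (t, 0) (by simpa using ht.ne') (add_nonneg hl1 ht.le) (by simpa using hl2)
    simp only [zero_mul, add_zero] at this
    linarith [pos_of_mul_pos_right this ht.le]
  have le2 : mean 2 l ≤ α₂ := by
    refine le_of_tendsto (lim2.mono_left (nhdsWithin_le_nhds (s := Ioi 0))) ?_
    filter_upwards [self_mem_nhdsWithin] with t (ht : 0 < t)
    have := key (0, t) (by simpa using ht.ne') (by simpa using hl1) (add_nonneg hl2 ht.le)
    simp only [zero_mul, zero_add] at this
    linarith [pos_of_mul_pos_right this ht.le]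
  refine ⟨l, hl1, hl2, le1, le2, ?_, ?_⟩
  · rcases hl1.eq_or_lt with h | h
    · rw [← h, zero_mul]
    -- Away from the boundary negative displacements are allowed too, which gives the reverse
    -- inequality.
    · have ge1 : α₁ ≤ mean 1 l := by
        refine ge_of_tendsto (lim1.mono_left (nhdsWithin_le_nhds (s := Iio 0))) ?_
        filter_upwards [self_mem_nhdsWithin,
          mem_nhdsWithin_of_mem_nhds (Ioi_mem_nhds (neg_lt_zero.2 h))]
          with t (ht : t < 0) (ht2 : -l.1 < t)
        have := key (t, 0) (by simpa using ht.ne) (by simp only; linarith) (by simpa using hl2)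
        simp only [zero_mul, add_zero] at this
        linarith [neg_of_mul_pos_right this ht.le]
      rw [le_antisymm le1 ge1, sub_self, mul_zero]
  · rcases hl2.eq_or_lt with h | h
    · rw [← h, zero_mul]
    · have ge2 : α₂ ≤ mean 2 l := by
        refine ge_of_tendsto (lim2.mono_left (nhdsWithin_le_nhds (s := Iio 0))) ?_
        filter_upwards [self_mem_nhdsWithin,
          mem_nhdsWithin_of_mem_nhds (Ioi_mem_nhds (neg_lt_zero.2 h))]
          with t (ht : t < 0) (ht2 : -l.2 < t)
        have := key (0, t) (by simpa using ht.ne) (by simpa using hl1) (by simp only; linarith)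
        simp only [zero_mul, zero_add] at this
        linarith [neg_of_mul_pos_right this ht.le]
      rw [le_antisymm le2 ge2, sub_self, mul_zero]

/-! ### The multiplier equations -/

theorem mom_one_ibp (l : ℝ × ℝ) :
    Real.exp (-(l.1 + l.2)) - 1 = -l.1 * zeta₀ l.1 l.2 - 2 * l.2 * mom 1 l := by
  have hd : ∀ y : ℝ, HasDerivAt (fun y => Real.exp (-l.1 * y - l.2 * y ^ 2))
      (-l.1 * Real.exp (-l.1 * y - l.2 * y ^ 2)
        - 2 * l.2 * (y ^ 1 * Real.exp (-l.1 * y - l.2 * y ^ 2))) y := by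
    intro y
    refine (((hasDerivAt_id' y).const_mul (-l.1)).sub
      ((hasDerivAt_pow 2 y).const_mul l.2)).exp.congr_deriv ?_
    change Real.exp (-l.1 * y - l.2 * y ^ 2) * _ = _
    push_cast
    ring
  have := intervalIntegral.integral_eq_sub_of_hasDerivAt (a := 0) (b := 1) (fun y _ => hd y)
    (Continuous.intervalIntegrable (by fun_prop) _ _)
  rw [intervalIntegral.integral_sub (Continuous.intervalIntegrable (by fun_prop) _ _)
    (Continuous.intervalIntegrable (by fun_prop) _ _), intervalIntegral.integral_const_mul,
    intervalIntegral.integral_const_mul] at this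
  unfold zeta₀ mom
  rw [this]
  simp
  ring_nf

/-- Integrates the derivative of `y ^ (k + 1)` times the weight. Together with `mom_one_ibp`, the
case without a power, it reduces the moments needed to `zeta₀` and exponentials. -/
theorem mom_succ_ibp (k : ℕ) (l : ℝ × ℝ) :
    Real.exp (-(l.1 + l.2))
      = (k + 1) * mom k l - l.1 * mom (k + 1) l - 2 * l.2 * mom (k + 2) l := by
  have hd : ∀ y : ℝ, HasDerivAt (fun y => y ^ (k + 1) * Real.exp (-l.1 * y - l.2 * y ^ 2))
      ((k + 1) * (y ^ k * Real.exp (-l.1 * y - l.2 * y ^ 2))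
        - l.1 * (y ^ (k + 1) * Real.exp (-l.1 * y - l.2 * y ^ 2))
        - 2 * l.2 * (y ^ (k + 2) * Real.exp (-l.1 * y - l.2 * y ^ 2))) y := by
    intro y
    refine ((hasDerivAt_pow (k + 1) y).mul (((hasDerivAt_id' y).const_mul (-l.1)).sub
      ((hasDerivAt_pow 2 y).const_mul l.2)).exp).congr_deriv ?_
    change _ * Real.exp (-l.1 * y - l.2 * y ^ 2) +
      y ^ (k + 1) * (Real.exp (-l.1 * y - l.2 * y ^ 2) * _) = _
    rw [Nat.add_sub_cancel]
    push_cast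
    ring
  have := intervalIntegral.integral_eq_sub_of_hasDerivAt (a := 0) (b := 1) (fun y _ => hd y)
    (Continuous.intervalIntegrable (by fun_prop) _ _)
  rw [intervalIntegral.integral_sub (Continuous.intervalIntegrable (by fun_prop) _ _)
    (Continuous.intervalIntegrable (by fun_prop) _ _),
    intervalIntegral.integral_sub (Continuous.intervalIntegrable (by fun_prop) _ _)
    (Continuous.intervalIntegrable (by fun_prop) _ _), intervalIntegral.integral_const_mul,
    intervalIntegral.integral_const_mul, intervalIntegral.integral_const_mul] at this
  unfold mom
  rw [this]
  simp
  ring_nf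

theorem mean_one_zero : mean 1 (0, 0) = 1 / 2 := by
  simp [mean, mom, zeta₀]

theorem mean_two_zero : mean 2 (0, 0) = 1 / 3 := by
  simp [mean, mom, zeta₀]
  norm_num

theorem exp_neg_ne_one {m : ℝ} (hm : m ≠ 0) : 1 - Real.exp (-m) ≠ 0 := by
  rw [sub_ne_zero, ne_comm, ne_eq, Real.exp_eq_one_iff]
  simpa using hm

/-- On the axis `l₂ = 0` the recurrences lose their highest moment and can be solved outright after
division by `m`, whatever its sign. -/
theorem firstEq_iff {α₁ m : ℝ} (hm : m ≠ 0) : FirstEq α₁ m ↔ mean 1 (m, 0) = α₁ := by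
  have h1 := mom_one_ibp (m, 0)
  have h2 := mom_succ_ibp 0 (m, 0)
  rw [mom_zero] at h2
  have he := exp_neg_ne_one hm
  simp only [add_zero, mul_zero, zero_mul, sub_zero, Nat.cast_zero, zero_add, one_mul] at h1 h2
  have hz : zeta₀ m 0 = (1 - Real.exp (-m)) / m := by field_simp; linarith
  have hm1 : mom 1 (m, 0) = (zeta₀ m 0 - Real.exp (-m)) / m := by field_simp; linarith
  have : mean 1 (m, 0) = 1 / m - Real.exp (-m) / (1 - Real.exp (-m)) := by
    rw [mean, hm1, hz]
    field_simp
  rw [this, FirstEq]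

theorem firstSlack_iff {α₂ m : ℝ} (hm : m ≠ 0) : FirstSlack α₂ m ↔ mean 2 (m, 0) ≤ α₂ := by
  have h1 := mom_one_ibp (m, 0)
  have h2 := mom_succ_ibp 0 (m, 0)
  have h3 := mom_succ_ibp 1 (m, 0)
  rw [mom_zero] at h2
  have he := exp_neg_ne_one hm
  simp only [add_zero, mul_zero, zero_mul, sub_zero, Nat.cast_zero, zero_add, one_mul,
    Nat.cast_one, Nat.reduceAdd] at h1 h2 h3
  have hz : zeta₀ m 0 = (1 - Real.exp (-m)) / m := by field_simp; linarith
  have hm1 : mom 1 (m, 0) = (zeta₀ m 0 - Real.exp (-m)) / m := by field_simp; linarith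
  have hm2 : mom 2 (m, 0) = (2 * mom 1 (m, 0) - Real.exp (-m)) / m := by field_simp; linarith
  have : mean 2 (m, 0)
      = 2 / m ^ 2 - Real.exp (-m) * (1 + 2 / m) / (1 - Real.exp (-m)) := by
    rw [mean, hm2, hm1, hz]
    field_simp
    ring
  rw [this, FirstSlack]

theorem Q_sub_Q {a b : ℝ} (h : a ≤ b) :
    Q a - Q b = (√(2 * Real.pi))⁻¹ * ∫ t in a..b, Real.exp (-t ^ 2 / 2) := by
  have hint : Integrable fun t : ℝ => Real.exp (-t ^ 2 / 2) := by
    convert integrable_exp_neg_mul_sq (b := 1 / 2) (by norm_num) using 2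
    ring_nf
  rw [Q, Q, ← mul_sub, intervalIntegral.integral_of_le h, ← Ioc_union_Ioi_eq_Ioi h,
    setIntegral_union Ioc_disjoint_Ioi_same measurableSet_Ioi hint.integrableOn hint.integrableOn,
    add_sub_cancel_right]

theorem Q_zero : Q 0 = 1 / 2 := by
  have h := integral_gaussian_Ioi (1 / 2)
  have e : ∀ t : ℝ, Real.exp (-t ^ 2 / 2) = Real.exp (-(1 / 2) * t ^ 2) := by
    intro t; ring_nf
  simp_rw [Q, e, h]
  rw [show Real.pi / (1 / 2) = 2 * Real.pi by ring]
  have : √(2 * Real.pi) ≠ 0 := by positivity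
  field_simp

/-- Completing the square: `t = r y + a / r` with `r = √(2 b)` turns the weight into a constant
times `exp (-t ^ 2 / 2)`. -/
theorem zeta₀_eq_Q (a : ℝ) {b : ℝ} (hb : 0 < b) :
    zeta₀ a b = √(Real.pi / b) * Real.exp (a ^ 2 / (4 * b))
      * (Q (a / √(2 * b)) - Q ((a + 2 * b) / √(2 * b))) := by
  set r := √(2 * b) with hr
  have hr0 : 0 < r := by positivity
  have hr2 : r ^ 2 = 2 * b := Real.sq_sqrt (by positivity)
  rw [Q_sub_Q (by gcongr; linarith)]
  have hsub := intervalIntegral.integral_comp_mul_add (a := 0) (b := 1)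
    (fun t : ℝ => Real.exp (-t ^ 2 / 2)) hr0.ne' (a / r)
  have e1 : r * 0 + a / r = a / r := by ring
  have e2 : r * 1 + a / r = (a + 2 * b) / r := by
    rw [← hr2]; field_simp; ring
  rw [e1, e2] at hsub
  have e3 : ∀ y : ℝ, Real.exp (-(r * y + a / r) ^ 2 / 2)
      = Real.exp (-(a ^ 2 / (4 * b))) * Real.exp (-a * y - b * y ^ 2) := by
    intro y
    rw [← Real.exp_add]
    congr 1
    have hb2 : b = r ^ 2 / 2 := by linarith
    rw [hb2]
    field_simp
    ring
  simp_rw [e3] at hsub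
  rw [intervalIntegral.integral_const_mul, smul_eq_mul] at hsub
  have e4 : ∫ t in (a / r)..((a + 2 * b) / r), Real.exp (-t ^ 2 / 2)
      = r * (Real.exp (-(a ^ 2 / (4 * b))) * zeta₀ a b) := by
    rw [zeta₀, hsub]; field_simp
  have e5 : √(Real.pi / b) * (√(2 * Real.pi))⁻¹ * r = 1 := by
    rw [hr, Real.sqrt_div Real.pi_pos.le, Real.sqrt_mul (by norm_num), Real.sqrt_mul (by norm_num)]
    have h1 : √Real.pi ≠ 0 := by positivity
    have h2 : √b ≠ 0 := by positivity
    field_simp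
  rw [e4, Real.exp_neg]
  have h6 := (Real.exp_pos (a ^ 2 / (4 * b))).ne'
  calc zeta₀ a b = (√(Real.pi / b) * (√(2 * Real.pi))⁻¹ * r) * zeta₀ a b := by rw [e5, one_mul]
    _ = _ := by field_simp

theorem sqrt_pi_mul {b : ℝ} (hb : 0 < b) : √(Real.pi * b) = b * √(Real.pi / b) := by
  rw [Real.sqrt_div Real.pi_pos.le, Real.sqrt_mul Real.pi_pos.le]
  have h2 : √b ≠ 0 := by positivity
  field_simp
  rw [Real.sq_sqrt hb.le]

theorem zeta₀_zero_left {b : ℝ} (hb : 0 < b) :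
    zeta₀ 0 b = √(Real.pi / b) * (1 / 2 - Q √(2 * b)) := by
  rw [zeta₀_eq_Q 0 hb, zero_div, Q_zero, zero_add, Real.div_sqrt]
  simp

theorem mean_eq_iff {k : ℕ} {l : ℝ × ℝ} {α : ℝ} : mean k l = α ↔ mom k l = α * zeta₀ l.1 l.2 :=
  div_eq_iff (zeta₀_pos _ _).ne'

theorem secondEq_iff {α₂ m : ℝ} (hm : 0 < m) : SecondEq α₂ m ↔ mean 2 (0, m) = α₂ := by
  have h2 := mom_succ_ibp 0 (0, m)
  rw [mom_zero] at h2
  simp only [zero_mul, sub_zero, Nat.cast_zero, zero_add, one_mul] at h2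
  have hz : 2 * √(Real.pi * m) * ((2 * m)⁻¹ - α₂) * (1 / 2 - Q √(2 * m))
      = zeta₀ 0 m - 2 * m * α₂ * zeta₀ 0 m := by
    rw [sqrt_pi_mul hm, zeta₀_zero_left hm]
    field_simp
  rw [SecondEq, hz, h2, mean_eq_iff]
  constructor
  · intro h
    apply mul_left_cancel₀ (mul_pos two_pos hm).ne'
    linarith
  · intro h
    rw [h]; ring

theorem secondSlack_iff {α₁ m : ℝ} (hm : 0 < m) : SecondSlack α₁ m ↔ mean 1 (0, m) ≤ α₁ := by
  have h1 := mom_one_ibp (0, m)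
  simp only [zero_mul, zero_add, neg_zero, zero_sub] at h1
  have hz : 2 * √(Real.pi * m) * α₁ * (1 / 2 - Q √(2 * m)) = 2 * m * (α₁ * zeta₀ 0 m) := by
    rw [sqrt_pi_mul hm, zeta₀_zero_left hm]
    ring
  have h3 : 1 - Real.exp (-m) = 2 * m * mom 1 (0, m) := by linarith
  rw [SecondSlack, hz, h3, mean, div_le_iff₀ (zeta₀_pos _ _)]
  exact mul_le_mul_iff_right₀ (by positivity)

theorem bothEq_iff {α₁ α₂ a b : ℝ} (hb : 0 < b) :
    BothEq α₁ α₂ a b ↔ mean 1 (a, b) = α₁ ∧ mean 2 (a, b) = α₂ := by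
  have h1 := mom_one_ibp (a, b)
  have h2 := mom_succ_ibp 0 (a, b)
  rw [mom_zero] at h2
  simp only [Nat.cast_zero, zero_add, one_mul] at h1 h2
  have hz1 : √(Real.pi * b) * Real.exp (a ^ 2 / (4 * b)) * (2 * α₁ + a / b)
      * (Q (a / √(2 * b)) - Q ((a + 2 * b) / √(2 * b)))
      = 2 * b * (α₁ * zeta₀ a b) + a * zeta₀ a b := by
    rw [sqrt_pi_mul hb, zeta₀_eq_Q a hb]
    field_simp
  have hz2 : √(Real.pi / b) * Real.exp (a ^ 2 / (4 * b))
        * (α₂ - (2 * b + a ^ 2) / (4 * b ^ 2))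
        * (Q (a / √(2 * b)) - Q ((a + 2 * b) / √(2 * b)))
      = α₂ * zeta₀ a b - (2 * b + a ^ 2) / (4 * b ^ 2) * zeta₀ a b := by
    rw [zeta₀_eq_Q a hb]
    ring
  have hm1 : mom 1 (a, b) = (1 - Real.exp (-(a + b)) - a * zeta₀ a b) / (2 * b) := by
    field_simp; linarith
  have hm2 : mom 2 (a, b) = (zeta₀ a b - a * mom 1 (a, b) - Real.exp (-(a + b))) / (2 * b) := by
    field_simp; linarith
  rw [BothEq, hz1, hz2, mean_eq_iff, mean_eq_iff]
  refine and_congr ?_ ?_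
  · rw [hm1, div_eq_iff (by positivity)]
    constructor <;> intro h <;> linarith
  · have : 1 / (2 * b) * Real.exp (-(a + b)) * (a / (2 * b) - 1) - a / (4 * b ^ 2)
        = mom 2 (a, b) - (2 * b + a ^ 2) / (4 * b ^ 2) * zeta₀ a b := by
      rw [hm2, hm1]; field_simp; ring
    rw [this, sub_left_inj, eq_comm]

/-! ### Variational bounds on mutual information -/

/-- Replacing the output law by any other reference law can only increase the divergence. -/
theorem mutualInfo_le_klDiv (γ : Measure (ℝ × ℝ)) [IsProbabilityMeasure γ]
    (R : Measure ℝ) [IsProbabilityMeasure R] :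
    mutualInfo γ ≤ InformationTheory.klDiv γ (γ.fst.prod R) := by
  -- The chain rule splits off the divergence of the first marginals, so the output is moved to the
  -- first coordinate. The term dropped is the divergence of the output law from `R`.
  set ρ := γ.map Prod.swap with hρ
  have hρ1 : ρ.fst = γ.snd := Measure.fst_map_swap
  have hγ : ρ.map Prod.swap = γ := by
    rw [hρ, Measure.map_map measurable_swap measurable_swap]
    simp
  have : IsProbabilityMeasure ρ := Measure.isProbabilityMeasure_map measurable_swap.aemeasurable
  calc mutualInfo γ
      = InformationTheory.klDiv (ρ.map Prod.swap) ((ρ.fst.prod γ.fst).map Prod.swap) := by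
        rw [mutualInfo, hγ, Measure.prod_swap, hρ1]
    _ ≤ InformationTheory.klDiv ρ (ρ.fst.prod γ.fst) :=
        InformationTheory.klDiv_map_le _ _ measurable_swap
    _ = InformationTheory.klDiv (ρ.fst.compProd ρ.condKernel)
          (ρ.fst.compProd (Kernel.const ℝ γ.fst)) := by
        rw [Measure.disintegrate, Measure.compProd_const]
    _ ≤ InformationTheory.klDiv (ρ.fst.compProd ρ.condKernel)
          (R.compProd (Kernel.const ℝ γ.fst)) := by
        rw [InformationTheory.klDiv_compProd_eq_add ρ.fst R]
        exact le_add_self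
    _ = InformationTheory.klDiv (γ.map Prod.swap) ((γ.fst.prod R).map Prod.swap) := by
        rw [Measure.disintegrate, Measure.compProd_const, Measure.prod_swap]
    _ ≤ _ := InformationTheory.klDiv_map_le _ _ measurable_swap

/-- The Donsker-Varadhan lower bound. -/
theorem ofReal_integral_le_klDiv {α : Type*} [MeasurableSpace α] {γ μ : Measure α}
    [IsProbabilityMeasure γ] [IsProbabilityMeasure μ] {f : α → ℝ} (hf : Measurable f)
    (hfγ : Integrable f γ) (h1 : ∫⁻ x, ENNReal.ofReal (Real.exp (f x)) ∂μ ≤ 1) :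
    ENNReal.ofReal (∫ x, f x ∂γ) ≤ InformationTheory.klDiv γ μ := by
  by_cases htop : InformationTheory.klDiv γ μ = ⊤
  · rw [htop]; exact le_top
  obtain ⟨hac, hint⟩ := InformationTheory.klDiv_ne_top_iff.1 htop
  have hexp : Integrable (fun x => Real.exp (f x)) μ := by
    refine ⟨hf.exp.aestronglyMeasurable, ?_⟩
    rw [hasFiniteIntegral_iff_ofReal (ae_of_all _ fun x => (Real.exp_pos _).le)]
    exact h1.trans_lt ENNReal.one_lt_top
  have hle : ∫ x, Real.exp (f x) ∂μ ≤ 1 := by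
    rw [integral_eq_lintegral_of_nonneg_ae (ae_of_all _ fun x => (Real.exp_pos _).le)
      hf.exp.aestronglyMeasurable]
    exact ENNReal.toReal_le_of_le_ofReal zero_le_one (by simpa using h1)
  -- The divergence of `γ` from `μ` tilted by `f` is nonnegative and equals `D(γ‖μ) - ∫ f ∂γ + log ∫
  -- exp f ∂μ`, whose last term is at most `0`.
  have := isProbabilityMeasure_tilted hexp
  have hnn := InformationTheory.integral_llr_add_sub_measure_univ_nonneg
    (hac.trans (absolutelyContinuous_tilted hexp))
    (integrable_llr_tilted_right hac hfγ hint hexp)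
  rw [integral_llr_tilted_right hac hfγ hexp hint] at hnn
  simp only [probReal_univ] at hnn
  have hlog := Real.log_nonpos (integral_exp_pos hexp).le hle
  rw [InformationTheory.klDiv_of_ac_of_integrable hac hint]
  apply ENNReal.ofReal_le_ofReal
  simp only [probReal_univ]
  linarith

theorem klDiv_withDensity_exp {α : Type*} [MeasurableSpace α] {μ : Measure α}
    [IsProbabilityMeasure μ] {f : α → ℝ} (hf : Measurable f) {γ : Measure α}
    [IsProbabilityMeasure γ] (hγ : γ = μ.withDensity fun x => ENNReal.ofReal (Real.exp (f x)))
    (hfγ : Integrable f γ) :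
    InformationTheory.klDiv γ μ = ENNReal.ofReal (∫ x, f x ∂γ) := by
  have hac : γ ≪ μ := hγ ▸ withDensity_absolutelyContinuous _ _
  have hllr : llr γ μ =ᵐ[γ] f := by
    have := Measure.rnDeriv_withDensity μ (f := fun x => ENNReal.ofReal (Real.exp (f x)))
      (by fun_prop)
    rw [← hγ] at this
    filter_upwards [hac.ae_le this] with x hx
    rw [llr, hx, ENNReal.toReal_ofReal (Real.exp_pos _).le, Real.log_exp]
  rw [InformationTheory.klDiv_of_ac_of_integrable hac ((integrable_congr hllr).2 hfγ),
    integral_congr_ae hllr]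
  simp

/-! ### The Gaussian channel -/

/-- The logarithm of the centred Gaussian density of variance `σ ^ 2`. -/
def logGauss (σ z : ℝ) : ℝ := -(Real.log (2 * Real.pi * σ ^ 2) / 2) - z ^ 2 / (2 * σ ^ 2)

/-- The variance of the noise. -/
def noiseVar (σ : ℝ) : ℝ≥0 := ⟨σ ^ 2, sq_nonneg σ⟩

theorem noiseVar_ne_zero {σ : ℝ} (hσ : 0 < σ) : noiseVar σ ≠ 0 := by
  have : (noiseVar σ : ℝ) ≠ 0 := (pow_pos hσ 2).ne'
  exact_mod_cast this

@[fun_prop]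
theorem continuous_logGauss (σ : ℝ) : Continuous (logGauss σ) := by
  unfold logGauss; fun_prop

theorem gaussianPDFReal_eq {σ : ℝ} (hσ : 0 < σ) (m z : ℝ) :
    gaussianPDFReal m (noiseVar σ) z = Real.exp (logGauss σ (z - m)) := by
  have h : ((noiseVar σ : ℝ≥0) : ℝ) = σ ^ 2 := rfl
  rw [gaussianPDFReal, h, logGauss, sub_eq_add_neg (-(Real.log _ / 2)), Real.exp_add,
    Real.exp_neg, ← Real.log_sqrt (by positivity), Real.exp_log (by positivity), neg_div]

theorem gaussianReal_eq_withDensity {σ : ℝ} (hσ : 0 < σ) :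
    gaussianReal 0 (noiseVar σ)
      = volume.withDensity fun z => ENNReal.ofReal (Real.exp (logGauss σ z)) := by
  rw [gaussianReal_of_var_ne_zero _ (noiseVar_ne_zero hσ)]
  congr 1; ext z
  rw [gaussianPDF, gaussianPDFReal_eq hσ, sub_zero]

theorem jointLaw_eq (σ : ℝ) (P : Measure ℝ) : jointLaw σ P
    = (P.prod (gaussianReal 0 (noiseVar σ))).map (fun q : ℝ × ℝ => (q.1, q.1 + q.2)) := rfl

instance (σ : ℝ) (P : Measure ℝ) [IsProbabilityMeasure P] :
    IsProbabilityMeasure (jointLaw σ P) :=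
  have := Measure.isProbabilityMeasure_map (μ := P.prod (gaussianReal 0 (noiseVar σ)))
    (f := fun q : ℝ × ℝ => (q.1, q.1 + q.2)) (by fun_prop)
  this

theorem jointLaw_fst (σ : ℝ) (P : Measure ℝ) [IsProbabilityMeasure P] :
    (jointLaw σ P).fst = P := by
  rw [jointLaw_eq, Measure.fst_map_prodMk (by fun_prop)]
  exact Measure.fst_prod

theorem lintegral_jointLaw {σ : ℝ} (hσ : 0 < σ) (P : Measure ℝ) [IsProbabilityMeasure P]
    {F : ℝ × ℝ → ℝ≥0∞} (hF : Measurable F) :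
    ∫⁻ p, F p ∂jointLaw σ P
      = ∫⁻ x, (∫⁻ y, ENNReal.ofReal (Real.exp (logGauss σ (y - x))) * F (x, y)) ∂P := by
  rw [jointLaw_eq, lintegral_map hF (by fun_prop), lintegral_prod _ (by fun_prop)]
  refine lintegral_congr fun x => ?_
  rw [gaussianReal_eq_withDensity hσ, lintegral_withDensity_eq_lintegral_mul _ (by fun_prop)
    (by fun_prop), ← lintegral_add_left_eq_self
      (fun y => ENNReal.ofReal (Real.exp (logGauss σ (y - x))) * F (x, y)) x]
  simp

theorem jointLaw_eq_withDensity {σ : ℝ} (hσ : 0 < σ) (P : Measure ℝ) [IsProbabilityMeasure P]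
    {G : ℝ → ℝ} (hG : Measurable G) :
    jointLaw σ P
      = (P.prod (volume.withDensity fun y => ENNReal.ofReal (Real.exp (-G y)))).withDensity
          fun p => ENNReal.ofReal (Real.exp (logGauss σ (p.2 - p.1) + G p.2)) := by
  refine Measure.ext_of_lintegral _ fun F hF => ?_
  rw [lintegral_jointLaw hσ P hF, lintegral_withDensity_eq_lintegral_mul _ (by fun_prop) hF,
    lintegral_prod _ (by fun_prop)]
  refine lintegral_congr fun x => ?_
  rw [lintegral_withDensity_eq_lintegral_mul _ (by fun_prop) (by fun_prop)]
  refine lintegral_congr fun y => ?_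
  simp only [Pi.mul_apply]
  rw [← mul_assoc, ← ENNReal.ofReal_mul (Real.exp_pos _).le, ← Real.exp_add]
  congr 4
  ring

/-! ### Moments of the input-noise pair -/

theorem integral_sq_gaussianReal (v : ℝ≥0) : ∫ z, z ^ 2 ∂gaussianReal 0 v = v := by
  rw [← variance_fun_id_gaussianReal (μ := 0) (v := v),
    variance_of_integral_eq_zero (by fun_prop) (by simp)]

theorem integrable_pow_gaussianReal (v : ℝ≥0) (k : ℕ) :
    Integrable (fun z => z ^ k) (gaussianReal 0 v) := by
  rw [← integrable_norm_iff (by fun_prop)]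
  simpa using (memLp_id_gaussianReal (μ := 0) (v := v) (k : ℝ≥0)).integrable_norm_pow'

theorem integrable_pow_of_ae_mem_Icc {P : Measure ℝ} [IsProbabilityMeasure P] {A : ℝ}
    (h : ∀ᵐ x ∂P, x ∈ Icc 0 A) (k : ℕ) : Integrable (fun x => x ^ k) P := by
  refine Integrable.of_bound (by fun_prop) (A ^ k) ?_
  filter_upwards [h] with x hx
  rw [norm_pow, Real.norm_of_nonneg hx.1]
  exact pow_le_pow_left₀ hx.1 hx.2 k

/-- Both bounds reduce to expectations of quadratics in input and noise. The terms in `d` and `f`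
vanish because the noise is centred and independent of the input. -/
theorem integrable_quadratic (σ : ℝ) {P : Measure ℝ} [IsProbabilityMeasure P] {A : ℝ}
    (h : ∀ᵐ x ∂P, x ∈ Icc 0 A) (a b c d e f : ℝ) :
    Integrable (fun q : ℝ × ℝ =>
      a + b * q.1 + c * q.1 ^ 2 + d * q.2 + e * q.2 ^ 2 + f * (q.1 * q.2))
      (P.prod (gaussianReal 0 (noiseVar σ))) ∧
    ∫ q : ℝ × ℝ, (a + b * q.1 + c * q.1 ^ 2 + d * q.2 + e * q.2 ^ 2 + f * (q.1 * q.2))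
        ∂(P.prod (gaussianReal 0 (noiseVar σ)))
      = a + b * ∫ x, x ∂P + c * ∫ x, x ^ 2 ∂P + e * σ ^ 2 := by
  set N := gaussianReal 0 (noiseVar σ)
  have ix : Integrable (fun q : ℝ × ℝ => q.1) (P.prod N) := by
    simpa using (integrable_pow_of_ae_mem_Icc h 1).comp_fst N
  have ix2 : Integrable (fun q : ℝ × ℝ => q.1 ^ 2) (P.prod N) :=
    (integrable_pow_of_ae_mem_Icc h 2).comp_fst N
  have iz : Integrable (fun q : ℝ × ℝ => q.2) (P.prod N) := by
    simpa using (integrable_pow_gaussianReal (noiseVar σ) 1).comp_snd P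
  have iz2 : Integrable (fun q : ℝ × ℝ => q.2 ^ 2) (P.prod N) :=
    (integrable_pow_gaussianReal (noiseVar σ) 2).comp_snd P
  have ixz : Integrable (fun q : ℝ × ℝ => q.1 * q.2) (P.prod N) := by
    simpa using (integrable_pow_of_ae_mem_Icc h 1).mul_prod
      (integrable_pow_gaussianReal (noiseVar σ) 1)
  have i1 := (integrable_const a (μ := P.prod N)).add (ix.const_mul b)
  have i2 := i1.add (ix2.const_mul c)
  have i3 := i2.add (iz.const_mul d)
  have i4 := i3.add (iz2.const_mul e)
  refine ⟨i4.add (ixz.const_mul f), ?_⟩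
  have ex : ∫ q : ℝ × ℝ, q.1 ∂(P.prod N) = ∫ x, x ∂P := by
    simpa using integral_prod_mul (μ := P) (ν := N) (fun x : ℝ => x) (fun _ => (1 : ℝ))
  have ex2 : ∫ q : ℝ × ℝ, q.1 ^ 2 ∂(P.prod N) = ∫ x, x ^ 2 ∂P := by
    simpa using integral_prod_mul (μ := P) (ν := N) (fun x : ℝ => x ^ 2) (fun _ => (1 : ℝ))
  have ez : ∫ q : ℝ × ℝ, q.2 ∂(P.prod N) = 0 := by
    simpa [N] using integral_prod_mul (μ := P) (ν := N) (fun _ => (1 : ℝ)) (fun z : ℝ => z)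
  have ez2 : ∫ q : ℝ × ℝ, q.2 ^ 2 ∂(P.prod N) = σ ^ 2 := by
    have := integral_prod_mul (μ := P) (ν := N) (fun _ => (1 : ℝ)) (fun z : ℝ => z ^ 2)
    rw [integral_sq_gaussianReal, show ((noiseVar σ : ℝ≥0) : ℝ) = σ ^ 2 from rfl] at this
    simpa only [one_mul, integral_const, probReal_univ, smul_eq_mul] using this
  have exz : ∫ q : ℝ × ℝ, q.1 * q.2 ∂(P.prod N) = 0 := by
    rw [integral_prod_mul (μ := P) (ν := N) (fun x : ℝ => x) (fun z : ℝ => z),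
      integral_id_gaussianReal, mul_zero]
  erw [integral_add i4 (ixz.const_mul f), integral_add i3 (iz2.const_mul e),
    integral_add i2 (iz.const_mul d), integral_add i1 (ix2.const_mul c),
    integral_add (integrable_const a) (ix.const_mul b)]
  simp only [integral_const_mul, ex, ex2, ez, ez2, exz, integral_const, probReal_univ]
  simp

/-! ### The upper bound -/

/-- The distance from a point of the line to `[0, 1]`. -/
def unitDist (u : ℝ) : ℝ := max 0 (max (-u) (u - 1))

@[fun_prop]
theorem continuous_unitDist : Continuous unitDist := by
  unfold unitDist; fun_prop

theorem unitDist_nonneg (u : ℝ) : 0 ≤ unitDist u := le_max_left _ _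

theorem unitDist_of_mem {u : ℝ} (h : u ∈ Icc (0 : ℝ) 1) : unitDist u = 0 := by
  have h1 := h.1
  have h2 := h.2
  rw [unitDist, max_eq_left]
  exact max_le (by linarith) (by linarith)

theorem unitDist_pos_of_notMem {u : ℝ} (h : u ∉ Icc (0 : ℝ) 1) : 0 < unitDist u := by
  rw [unitDist, lt_max_iff, lt_max_iff]
  by_contra! hc
  exact h ⟨by linarith [hc.2.1], by linarith [hc.2.2]⟩

theorem sq_le_unitDist (u : ℝ) : u ^ 2 ≤ 2 * unitDist u ^ 2 + 2 := by
  have h0 := unitDist_nonneg u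
  have h1 : -u ≤ unitDist u := (le_max_left _ _).trans (le_max_right _ _)
  have h2 : u - 1 ≤ unitDist u := (le_max_right _ _).trans (le_max_right _ _)
  have h3 : u ^ 2 ≤ (unitDist u + 1) ^ 2 := sq_le_sq' (by linarith) (by linarith)
  nlinarith [sq_nonneg (unitDist u - 1)]

theorem unitDist_add_le {x z A : ℝ} (hA : 0 < A) (hx : x ∈ Icc 0 A) :
    unitDist ((x + z) / A) ≤ |z| / A := by
  have h1 := neg_abs_le z
  have h2 := le_abs_self z
  refine max_le (by positivity) (max_le ?_ ?_)
  · rw [← neg_div]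
    gcongr
    linarith [hx.1]
  · rw [div_sub_one hA.ne']
    gcongr
    linarith [hx.2]

/-- The exponent of the reference output density, in the scaled variable `u = y / A`. -/
def refExponent (l : ℝ × ℝ) (A u : ℝ) : ℝ := l.1 * u + l.2 * u ^ 2 + A * unitDist u ^ 2

@[fun_prop]
theorem continuous_refExponent (l : ℝ × ℝ) (A : ℝ) : Continuous (refExponent l A) := by
  unfold refExponent; fun_prop

/-- The normalizing constant of the reference output density. -/
def refNorm (l : ℝ × ℝ) (A : ℝ) : ℝ := ∫ u, Real.exp (-refExponent l A u)

theorem integrable_exp_refExponent {l : ℝ × ℝ} (hl : 0 ≤ l.2) {A : ℝ} (hA : 0 < A) :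
    Integrable fun u => Real.exp (-refExponent l A u) := by
  refine Integrable.mono' ((integrable_exp_neg_mul_sq (b := A / 4) (by positivity)).const_mul
    (Real.exp (A + l.1 ^ 2 / A))) (by fun_prop) (ae_of_all _ fun u => ?_)
  rw [Real.norm_of_nonneg (Real.exp_pos _).le, ← Real.exp_add, Real.exp_le_exp, refExponent]
  have h1 := mul_le_mul_of_nonneg_left (sq_le_unitDist u) hA.le
  have h2 := mul_nonneg hl (sq_nonneg u)
  -- The penalty supplies `A / 2 * u ^ 2` up to a constant; half of it absorbs the linear term
  -- through this square.
  have h3 : 0 ≤ (l.1 + A / 2 * u) ^ 2 / A := by positivity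
  have h4 : (l.1 + A / 2 * u) ^ 2 / A = l.1 ^ 2 / A + l.1 * u + A / 4 * u ^ 2 := by
    field_simp; ring
  linarith

theorem refNorm_pos {l : ℝ × ℝ} (hl : 0 ≤ l.2) {A : ℝ} (hA : 0 < A) : 0 < refNorm l A :=
  integral_exp_pos (integrable_exp_refExponent hl hA)

/-- The penalty weight `A` diverges, so the mass outside `[0, 1]` disappears; yet it is small enough
that noise of scaled size `|z| / A` costs only `z ^ 2 / A`. -/
theorem tendsto_refNorm {l : ℝ × ℝ} (hl : 0 ≤ l.2) :
    Tendsto (refNorm l) atTop (𝓝 (zeta₀ l.1 l.2)) := by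
  have e : zeta₀ l.1 l.2
      = ∫ u, (Icc (0 : ℝ) 1).indicator (fun u => Real.exp (-l.1 * u - l.2 * u ^ 2)) u := by
    rw [integral_indicator measurableSet_Icc, integral_Icc_eq_integral_Ioc,
      ← intervalIntegral.integral_of_le zero_le_one]
    rfl
  rw [e]
  refine tendsto_integral_filter_of_dominated_convergence
    (fun u => Real.exp (-refExponent l 1 u)) (Eventually.of_forall fun A => by fun_prop) ?_
    (integrable_exp_refExponent hl one_pos) (ae_of_all _ fun u => ?_)
  · filter_upwards [eventually_ge_atTop 1] with A hA
    refine ae_of_all _ fun u => ?_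
    rw [Real.norm_of_nonneg (Real.exp_pos _).le, Real.exp_le_exp, refExponent, refExponent]
    have := mul_le_mul_of_nonneg_right hA (sq_nonneg (unitDist u))
    linarith
  · by_cases hu : u ∈ Icc (0 : ℝ) 1
    · rw [indicator_of_mem hu]
      refine tendsto_const_nhds.congr fun A => ?_
      rw [refExponent, unitDist_of_mem hu]
      ring_nf
    · rw [indicator_of_notMem hu]
      refine Real.tendsto_exp_neg_atTop_nhds_zero.comp ?_
      exact tendsto_atTop_add_const_left _ _
        (tendsto_id.atTop_mul_const (pow_pos (unitDist_pos_of_notMem hu) 2))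

/-- The upper bound on the capacity furnished by the reference output density. -/
def upperBound (σ α₁ α₂ : ℝ) (l : ℝ × ℝ) (A : ℝ) : ℝ :=
  -(Real.log (2 * Real.pi * σ ^ 2) / 2) - 1 / 2 + Real.log A + Real.log (refNorm l A)
    + l.1 * α₁ + l.2 * α₂ + l.2 * σ ^ 2 / A ^ 2 + σ ^ 2 / A

theorem mutualInfo_le {σ α₁ α₂ : ℝ} (hσ : 0 < σ) {l : ℝ × ℝ} (hl1 : 0 ≤ l.1) (hl2 : 0 ≤ l.2)
    {A : ℝ} (hA : 0 < A) {P : Measure ℝ} (hP : Admissible α₁ α₂ A P) :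
    mutualInfo (jointLaw σ P) ≤ ENNReal.ofReal (upperBound σ α₁ α₂ l A) := by
  have := hP.isProbabilityMeasure
  have hν := refNorm_pos hl2 hA
  let G : ℝ → ℝ := fun y => refExponent l A (y / A) + Real.log A + Real.log (refNorm l A)
  have hG : Continuous G := by fun_prop
  set R : Measure ℝ := volume.withDensity fun y => ENNReal.ofReal (Real.exp (-G y)) with hR
  have hexp : ∀ y, Real.exp (-G y)
      = (A * refNorm l A)⁻¹ * Real.exp (-refExponent l A (A⁻¹ * y)) := by
    intro y
    rw [← Real.exp_log (inv_pos.2 (mul_pos hA hν)), ← Real.exp_add, Real.log_inv,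
      Real.log_mul hA.ne' hν.ne', inv_mul_eq_div]
    simp only [G]
    ring_nf
  have hRint : Integrable fun y => Real.exp (-G y) := by
    simp_rw [hexp]
    exact ((integrable_exp_refExponent hl2 hA).comp_mul_left' (inv_pos.2 hA).ne').const_mul _
  have hRone : ∫ y, Real.exp (-G y) = 1 := by
    simp_rw [hexp]
    rw [integral_const_mul, Measure.integral_comp_mul_left
      (fun u => Real.exp (-refExponent l A u)), inv_inv, abs_of_pos hA, smul_eq_mul]
    change (A * refNorm l A)⁻¹ * (A * refNorm l A) = 1
    exact inv_mul_cancel₀ (mul_pos hA hν).ne'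
  have hRprob : IsProbabilityMeasure R := by
    refine ⟨?_⟩
    rw [hR, withDensity_apply _ MeasurableSet.univ, Measure.restrict_univ,
      ← ofReal_integral_eq_lintegral_ofReal hRint (ae_of_all _ fun y => (Real.exp_pos _).le),
      hRone, ENNReal.ofReal_one]
  set N := gaussianReal 0 (noiseVar σ) with hN
  let f : ℝ × ℝ → ℝ := fun p => logGauss σ (p.2 - p.1) + G p.2
  have hf : Continuous f := by fun_prop
  have hmap : Measurable fun q : ℝ × ℝ => (q.1, q.1 + q.2) := by fun_prop
  let c := -(Real.log (2 * Real.pi * σ ^ 2) / 2) + Real.log A + Real.log (refNorm l A)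
  -- The parameter `s` is `0` for the log-density without penalty and `1 / A` for the quadratic that
  -- also dominates the penalty.
  let q₀ : ℝ → ℝ × ℝ → ℝ := fun s q => c + l.1 / A * q.1 + l.2 / A ^ 2 * q.1 ^ 2 + l.1 / A * q.2
    + (l.2 / A ^ 2 - 1 / (2 * σ ^ 2) + s) * q.2 ^ 2 + 2 * l.2 / A ^ 2 * (q.1 * q.2)
  have hq₀ : ∀ s, Integrable (q₀ s) (P.prod N) := fun s =>
    (integrable_quadratic σ hP.peak _ _ _ _ _ _).1
  have hq₁ := (integrable_quadratic σ hP.peak c (l.1 / A) (l.2 / A ^ 2) (l.1 / A)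
    (l.2 / A ^ 2 - 1 / (2 * σ ^ 2) + 1 / A) (2 * l.2 / A ^ 2)).2
  have hfq : ∀ q : ℝ × ℝ, f (q.1, q.1 + q.2)
      = q₀ 0 q + A * unitDist ((q.1 + q.2) / A) ^ 2 := by
    intro q
    simp only [f, G, q₀, c, logGauss, refExponent, add_sub_cancel_left]
    field_simp
    ring
  have hbound : ∀ᵐ q ∂(P.prod N), A * unitDist ((q.1 + q.2) / A) ^ 2 ≤ 1 / A * q.2 ^ 2 := by
    filter_upwards [Measure.quasiMeasurePreserving_fst.ae hP.peak] with q hq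
    calc A * unitDist ((q.1 + q.2) / A) ^ 2 ≤ A * (|q.2| / A) ^ 2 := by
          gcongr
          · exact unitDist_nonneg _
          · exact unitDist_add_le hA hq
      _ = 1 / A * q.2 ^ 2 := by rw [div_pow, sq_abs]; field_simp
  have hint : Integrable (fun q : ℝ × ℝ => f (q.1, q.1 + q.2)) (P.prod N) := by
    simp_rw [hfq]
    refine (hq₀ 0).add (Integrable.mono'
      (((integrable_pow_gaussianReal (noiseVar σ) 2).comp_snd P).const_mul (1 / A))
      (by fun_prop) ?_)
    filter_upwards [hbound] with q hq
    rwa [Real.norm_of_nonneg (mul_nonneg hA.le (sq_nonneg _))]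
  have hfγ : Integrable f (jointLaw σ P) := by
    rw [jointLaw_eq, integrable_map_measure hf.aestronglyMeasurable hmap.aemeasurable]
    exact hint
  have hval : ∫ p, f p ∂jointLaw σ P ≤ upperBound σ α₁ α₂ l A := by
    rw [jointLaw_eq, integral_map hmap.aemeasurable hf.aestronglyMeasurable]
    calc ∫ q : ℝ × ℝ, f (q.1, q.1 + q.2) ∂(P.prod N) ≤ ∫ q, q₀ (1 / A) q ∂(P.prod N) := by
          refine integral_mono_ae hint (hq₀ _) ?_
          filter_upwards [hbound] with q hq
          simp only [hfq]
          simp only [q₀] at hq ⊢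
          linarith
      _ = c + l.1 / A * ∫ x, x ∂P + l.2 / A ^ 2 * ∫ x, x ^ 2 ∂P
            + (l.2 / A ^ 2 - 1 / (2 * σ ^ 2) + 1 / A) * σ ^ 2 := hq₁
      _ ≤ c + l.1 / A * (α₁ * A) + l.2 / A ^ 2 * (α₂ * A ^ 2)
            + (l.2 / A ^ 2 - 1 / (2 * σ ^ 2) + 1 / A) * σ ^ 2 := by
          gcongr
          · exact hP.first_moment
          · exact hP.second_moment
      _ = upperBound σ α₁ α₂ l A := by
          simp only [c, upperBound]
          field_simp
          ring
  calc mutualInfo (jointLaw σ P)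
      ≤ InformationTheory.klDiv (jointLaw σ P) ((jointLaw σ P).fst.prod R) :=
        mutualInfo_le_klDiv _ R
    _ = ENNReal.ofReal (∫ p, f p ∂jointLaw σ P) := by
        rw [jointLaw_fst]
        exact klDiv_withDensity_exp hf.measurable
          (jointLaw_eq_withDensity hσ P hG.measurable) hfγ
    _ ≤ _ := ENNReal.ofReal_le_ofReal hval

theorem capacity_le {σ : ℝ} (α₁ α₂ : ℝ) (hσ : 0 < σ) {l : ℝ × ℝ} (hl1 : 0 ≤ l.1)
    (hl2 : 0 ≤ l.2) {A : ℝ} (hA : 0 < A) :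
    capacity σ α₁ α₂ A ≤ ENNReal.ofReal (upperBound σ α₁ α₂ l A) :=
  iSup₂_le fun _ hP => mutualInfo_le hσ hl1 hl2 hA hP

theorem capacity_ne_top {σ : ℝ} (α₁ α₂ : ℝ) (hσ : 0 < σ) {A : ℝ} (hA : 0 < A) :
    capacity σ α₁ α₂ A ≠ ⊤ :=
  ((capacity_le α₁ α₂ hσ (l := (0, 0)) le_rfl le_rfl hA).trans_lt ENNReal.ofReal_lt_top).ne

/-! ### The lower bound -/

/-- The law on `[0, 1]` with density `exp (-l₁ u - l₂ u ^ 2) / ζ₀`. -/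
def tiltedLaw (l : ℝ × ℝ) : Measure ℝ :=
  (volume.restrict (Icc (0 : ℝ) 1)).withDensity fun u =>
    ENNReal.ofReal (Real.exp (-l.1 * u - l.2 * u ^ 2) / zeta₀ l.1 l.2)

theorem integral_pow_tiltedLaw (k : ℕ) (l : ℝ × ℝ) : ∫ u, u ^ k ∂tiltedLaw l = mean k l := by
  have hz := zeta₀_pos l.1 l.2
  rw [tiltedLaw, integral_withDensity_eq_integral_toReal_smul (by fun_prop)
    (ae_of_all _ fun _ => ENNReal.ofReal_lt_top), integral_Icc_eq_integral_Ioc,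
    ← intervalIntegral.integral_of_le zero_le_one, mean, mom, ← intervalIntegral.integral_div]
  refine intervalIntegral.integral_congr fun u _ => ?_
  simp only [smul_eq_mul]
  rw [ENNReal.toReal_ofReal (by positivity)]
  ring

instance (l : ℝ × ℝ) : IsProbabilityMeasure (tiltedLaw l) := by
  have hz := zeta₀_pos l.1 l.2
  refine ⟨?_⟩
  rw [tiltedLaw, withDensity_apply _ MeasurableSet.univ, Measure.restrict_univ,
    ← ofReal_integral_eq_lintegral_ofReal
      (Continuous.integrableOn_Icc (by fun_prop)) (ae_of_all _ fun u => by positivity),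
    integral_Icc_eq_integral_Ioc, ← intervalIntegral.integral_of_le zero_le_one,
    intervalIntegral.integral_div]
  change ENNReal.ofReal (zeta₀ l.1 l.2 / zeta₀ l.1 l.2) = 1
  rw [div_self hz.ne', ENNReal.ofReal_one]

/-- The input law that is asymptotically optimal when `l` satisfies the KKT conditions. -/
def inputLaw (l : ℝ × ℝ) (A : ℝ) : Measure ℝ := (tiltedLaw l).map (A * ·)

instance (l : ℝ × ℝ) (A : ℝ) : IsProbabilityMeasure (inputLaw l A) :=
  Measure.isProbabilityMeasure_map (by fun_prop)

theorem integral_pow_inputLaw (k : ℕ) (l : ℝ × ℝ) (A : ℝ) :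
    ∫ x, x ^ k ∂inputLaw l A = A ^ k * mean k l := by
  rw [inputLaw, integral_map (by fun_prop) (by fun_prop), ← integral_pow_tiltedLaw,
    ← integral_const_mul]
  simp_rw [mul_pow]

theorem inputLaw_peak (l : ℝ × ℝ) {A : ℝ} (hA : 0 ≤ A) :
    ∀ᵐ x ∂inputLaw l A, x ∈ Icc 0 A := by
  refine (ae_map_iff (p := fun x => x ∈ Icc 0 A) (by fun_prop) measurableSet_Icc).2 ?_
  refine (withDensity_absolutelyContinuous _ _).ae_le ?_
  filter_upwards [ae_restrict_mem measurableSet_Icc] with u hu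
  exact ⟨mul_nonneg hA hu.1, mul_le_of_le_one_right hA hu.2⟩

theorem inputLaw_admissible {α₁ α₂ : ℝ} {l : ℝ × ℝ} (hl : KKT α₁ α₂ l) {A : ℝ} (hA : 0 ≤ A) :
    Admissible α₁ α₂ A (inputLaw l A) where
  isProbabilityMeasure := inferInstance
  peak := inputLaw_peak l hA
  first_moment := by
    have := integral_pow_inputLaw 1 l A
    simp only [pow_one] at this
    rw [this, mul_comm]
    exact mul_le_mul_of_nonneg_right hl.mean_one_le hA
  second_moment := by
    rw [integral_pow_inputLaw, mul_comm]
    exact mul_le_mul_of_nonneg_right hl.mean_two_le (sq_nonneg A)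

/-- The exponent of an upper bound on the output density. -/
def outExponent (σ : ℝ) (l : ℝ × ℝ) (A y : ℝ) : ℝ :=
  Real.log A + Real.log (zeta₀ l.1 l.2) + l.1 * y / A + l.2 * y ^ 2 / A ^ 2
    - σ ^ 2 / 2 * (l.1 / A + 2 * l.2 * y / A ^ 2) ^ 2

@[fun_prop]
theorem continuous_outExponent (σ : ℝ) (l : ℝ × ℝ) (A : ℝ) :
    Continuous (outExponent σ l A) := by
  unfold outExponent; fun_prop

/-- The density of the output is at most `exp (-outExponent)`. -/
theorem output_density_le {σ : ℝ} (hσ : 0 < σ) {l : ℝ × ℝ} (hl : 0 ≤ l.2) {A : ℝ} (hA : 0 < A)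
    (y : ℝ) :
    ∫⁻ x, ENNReal.ofReal (Real.exp (logGauss σ (y - x))) ∂inputLaw l A
      ≤ ENNReal.ofReal (Real.exp (-outExponent σ l A y)) := by
  have hz := zeta₀_pos l.1 l.2
  -- With `z = y - A u`, the exponent has slope `l₁ / A + 2 l₂ y / A ^ 2` in `z`. Tilting the
  -- Gaussian by it shifts the mean to `m` and produces the last term of `outExponent`; the
  -- remaining `-l₂ (z / A) ^ 2` is nonpositive and is discarded.
  set m := σ ^ 2 * (l.1 / A + 2 * l.2 * y / A ^ 2) with hm
  have hI : Integrable fun u => gaussianPDFReal m (noiseVar σ) (y - A * u) :=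
    ((integrable_gaussianPDFReal m (noiseVar σ)).comp_sub_left y).comp_mul_left'
      (g := fun t => gaussianPDFReal m (noiseVar σ) (y - t)) hA.ne'
  have hI1 : ∫ u, gaussianPDFReal m (noiseVar σ) (y - A * u) = A⁻¹ := by
    rw [Measure.integral_comp_mul_left (fun t => gaussianPDFReal m (noiseVar σ) (y - t)),
      integral_sub_left_eq_self (fun t => gaussianPDFReal m (noiseVar σ) t),
      integral_gaussianPDFReal_eq_one m (noiseVar_ne_zero hσ), smul_eq_mul, mul_one,
      abs_of_pos (inv_pos.2 hA)]
  have hpt : ∀ u, Real.exp (-l.1 * u - l.2 * u ^ 2) / zeta₀ l.1 l.2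
        * Real.exp (logGauss σ (y - A * u))
      ≤ Real.exp (-outExponent σ l A y) * A * gaussianPDFReal m (noiseVar σ) (y - A * u) := by
    intro u
    rw [gaussianPDFReal_eq hσ, ← Real.exp_log hz, ← Real.exp_sub, ← Real.exp_add]
    nth_rw 3 [← Real.exp_log hA]
    rw [← Real.exp_add, ← Real.exp_add, Real.exp_le_exp]
    have key : -outExponent σ l A y + Real.log A + logGauss σ (y - A * u - m)
        - (-l.1 * u - l.2 * u ^ 2 - Real.log (zeta₀ l.1 l.2) + logGauss σ (y - A * u))
        = l.2 * ((y - A * u) / A) ^ 2 := by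
      rw [outExponent, logGauss, logGauss, hm]
      field_simp
      ring
    have := mul_nonneg hl (sq_nonneg ((y - A * u) / A))
    linarith
  calc ∫⁻ x, ENNReal.ofReal (Real.exp (logGauss σ (y - x))) ∂inputLaw l A
      = ∫⁻ u in Icc (0 : ℝ) 1, ENNReal.ofReal (Real.exp (-l.1 * u - l.2 * u ^ 2) / zeta₀ l.1 l.2
          * Real.exp (logGauss σ (y - A * u))) := by
        rw [inputLaw, lintegral_map (by fun_prop) (by fun_prop), tiltedLaw,
          lintegral_withDensity_eq_lintegral_mul _ (by fun_prop) (by fun_prop)]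
        refine lintegral_congr fun u => ?_
        rw [Pi.mul_apply, ← ENNReal.ofReal_mul (by positivity)]
    _ ≤ ∫⁻ u, ENNReal.ofReal (Real.exp (-l.1 * u - l.2 * u ^ 2) / zeta₀ l.1 l.2
          * Real.exp (logGauss σ (y - A * u))) := setLIntegral_le_lintegral _ _
    _ ≤ ∫⁻ u, ENNReal.ofReal (Real.exp (-outExponent σ l A y) * A
          * gaussianPDFReal m (noiseVar σ) (y - A * u)) :=
        lintegral_mono fun u => ENNReal.ofReal_le_ofReal (hpt u)
    _ = ENNReal.ofReal (Real.exp (-outExponent σ l A y)) := by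
        rw [← ofReal_integral_eq_lintegral_ofReal (hI.const_mul _)
          (ae_of_all _ fun u => mul_nonneg (by positivity) (gaussianPDFReal_nonneg _ _ _)),
          integral_const_mul, hI1, mul_assoc, mul_inv_cancel₀ hA.ne', mul_one]

/-- The lower bound on the capacity furnished by `inputLaw`. -/
def lowerBound (σ : ℝ) (l : ℝ × ℝ) (A : ℝ) : ℝ :=
  -(Real.log (2 * Real.pi * σ ^ 2) / 2) - 1 / 2 + Real.log A + Real.log (zeta₀ l.1 l.2)
    + l.1 * mean 1 l + l.2 * (mean 2 l + σ ^ 2 / A ^ 2)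
    - σ ^ 2 / (2 * A ^ 2) * (l.1 ^ 2 + 4 * l.1 * l.2 * mean 1 l
      + 4 * l.2 ^ 2 * (mean 2 l + σ ^ 2 / A ^ 2))

theorem le_mutualInfo {σ : ℝ} (hσ : 0 < σ) {l : ℝ × ℝ} (hl : 0 ≤ l.2) {A : ℝ} (hA : 0 < A) :
    ENNReal.ofReal (lowerBound σ l A) ≤ mutualInfo (jointLaw σ (inputLaw l A)) := by
  set P := inputLaw l A with hP
  set γ := jointLaw σ P with hγ
  set N := gaussianReal 0 (noiseVar σ) with hN
  let f : ℝ × ℝ → ℝ := fun p => logGauss σ (p.2 - p.1) + outExponent σ l A p.2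
  have hf : Continuous f := by fun_prop
  have hmap : Measurable fun q : ℝ × ℝ => (q.1, q.1 + q.2) := by fun_prop
  -- For fixed `y`, the integral of `exp f` over `x` is the output density times `exp
  -- (outExponent)`, hence at most `1`.
  have h1 : ∫⁻ p, ENNReal.ofReal (Real.exp (f p)) ∂(γ.fst.prod γ.snd) ≤ 1 := by
    rw [hγ, jointLaw_fst, ← hγ, lintegral_prod_symm' _ (by fun_prop)]
    calc ∫⁻ y, (∫⁻ x, ENNReal.ofReal (Real.exp (f (x, y))) ∂P) ∂γ.snd
        ≤ ∫⁻ _, 1 ∂γ.snd := by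
          refine lintegral_mono fun y => ?_
          simp only [f, Real.exp_add]
          simp_rw [ENNReal.ofReal_mul (Real.exp_pos _).le]
          rw [lintegral_mul_const _ (by fun_prop)]
          refine (mul_le_mul_left (output_density_le hσ hl hA y) _).trans ?_
          rw [← ENNReal.ofReal_mul (Real.exp_pos _).le, ← Real.exp_add]
          simp
      _ = 1 := by simp
  -- Up to the Gaussian constant contained in `c`, these are the coefficients of `outExponent` as
  -- the polynomial `c + b y + e y ^ 2`, with `y = x + z` still to be expanded.
  let c := -(Real.log (2 * Real.pi * σ ^ 2) / 2) + Real.log A + Real.log (zeta₀ l.1 l.2)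
    - σ ^ 2 / 2 * (l.1 / A) ^ 2
  let b := l.1 / A - 2 * σ ^ 2 * l.1 * l.2 / A ^ 3
  let e := l.2 / A ^ 2 - 2 * σ ^ 2 * l.2 ^ 2 / A ^ 4
  have hfq : (fun q : ℝ × ℝ => f (q.1, q.1 + q.2)) = fun q : ℝ × ℝ =>
      c + b * q.1 + e * q.1 ^ 2 + b * q.2 + (e - 1 / (2 * σ ^ 2)) * q.2 ^ 2
        + 2 * e * (q.1 * q.2) := by
    ext q
    simp only [f, c, b, e, logGauss, outExponent, add_sub_cancel_left]
    field_simp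
    ring
  obtain ⟨hq1, hq2⟩ := integrable_quadratic σ (inputLaw_peak l hA.le) c b e b
    (e - 1 / (2 * σ ^ 2)) (2 * e)
  have hfγ : Integrable f γ := by
    rw [hγ, jointLaw_eq, integrable_map_measure hf.aestronglyMeasurable hmap.aemeasurable]
    change Integrable (fun q : ℝ × ℝ => f (q.1, q.1 + q.2)) _
    rw [hfq]
    exact hq1
  have hval : ∫ p, f p ∂γ = lowerBound σ l A := by
    rw [hγ, jointLaw_eq, integral_map hmap.aemeasurable hf.aestronglyMeasurable, hfq, hq2]
    have e1 := integral_pow_inputLaw 1 l A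
    simp only [pow_one] at e1
    rw [e1, integral_pow_inputLaw]
    simp only [c, b, e, lowerBound]
    field_simp
    ring
  rw [← hval]
  exact ofReal_integral_le_klDiv hf.measurable hfγ h1

theorem le_capacity {σ α₁ α₂ : ℝ} (hσ : 0 < σ) {l : ℝ × ℝ} (hl : KKT α₁ α₂ l) {A : ℝ}
    (hA : 0 < A) : ENNReal.ofReal (lowerBound σ l A) ≤ capacity σ α₁ α₂ A :=
  (le_mutualInfo hσ hl.snd_nonneg hA).trans
    (le_iSup₂_of_le (inputLaw l A) (inputLaw_admissible hl hA.le) le_rfl)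

/-! ### The high-SNR limit -/

theorem log_div_sqrt {σ : ℝ} (hσ : 0 < σ) {A : ℝ} (hA : 0 < A) :
    Real.log (A / √(2 * Real.pi * Real.exp 1 * σ ^ 2))
      = Real.log A - Real.log (2 * Real.pi * σ ^ 2) / 2 - 1 / 2 := by
  rw [Real.log_div hA.ne' (by positivity), Real.log_sqrt (by positivity),
    show 2 * Real.pi * Real.exp 1 * σ ^ 2 = 2 * Real.pi * σ ^ 2 * Real.exp 1 by ring,
    Real.log_mul (by positivity) (Real.exp_pos _).ne', Real.log_exp]
  ring

theorem KKT.hasHighSNRLimit {σ α₁ α₂ : ℝ} (hσ : 0 < σ) {l : ℝ × ℝ} (hl : KKT α₁ α₂ l) :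
    HasHighSNRLimit σ α₁ α₂ (Gam α₁ α₂ l) := by
  have hinv : Tendsto (fun A : ℝ => A⁻¹) atTop (𝓝 0) := tendsto_inv_atTop_zero
  have hlow : Tendsto (fun A => lowerBound σ l A
      - Real.log (A / √(2 * Real.pi * Real.exp 1 * σ ^ 2))) atTop (𝓝 (Gam α₁ α₂ l)) := by
    have hcont : Continuous fun t : ℝ => Real.log (zeta₀ l.1 l.2)
        + l.1 * mean 1 l + l.2 * (mean 2 l + σ ^ 2 * t ^ 2)
        - σ ^ 2 / 2 * t ^ 2 * (l.1 ^ 2 + 4 * l.1 * l.2 * mean 1 l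
          + 4 * l.2 ^ 2 * (mean 2 l + σ ^ 2 * t ^ 2)) := by fun_prop
    have h := (hcont.tendsto 0).comp hinv
    have e : Gam α₁ α₂ l = Real.log (zeta₀ l.1 l.2)
        + l.1 * mean 1 l + l.2 * (mean 2 l + σ ^ 2 * 0 ^ 2)
        - σ ^ 2 / 2 * 0 ^ 2 * (l.1 ^ 2 + 4 * l.1 * l.2 * mean 1 l
          + 4 * l.2 ^ 2 * (mean 2 l + σ ^ 2 * 0 ^ 2)) := by
      rw [Gam]
      linarith [hl.fst_slack, hl.snd_slack]
    rw [← e] at h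
    refine h.congr' ?_
    filter_upwards [eventually_gt_atTop 0] with A hA
    rw [log_div_sqrt hσ hA, lowerBound, Function.comp_apply]
    field_simp
    ring
  have hup : Tendsto (fun A => upperBound σ α₁ α₂ l A
      - Real.log (A / √(2 * Real.pi * Real.exp 1 * σ ^ 2))) atTop (𝓝 (Gam α₁ α₂ l)) := by
    have hcont : Continuous fun t : ℝ => l.1 * α₁ + l.2 * α₂ + l.2 * σ ^ 2 * t ^ 2 + σ ^ 2 * t := by
      fun_prop
    have h := ((tendsto_refNorm hl.snd_nonneg).log (zeta₀_pos _ _).ne').add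
      ((hcont.tendsto 0).comp hinv)
    have e : Gam α₁ α₂ l = Real.log (zeta₀ l.1 l.2)
        + (l.1 * α₁ + l.2 * α₂ + l.2 * σ ^ 2 * 0 ^ 2 + σ ^ 2 * 0) := by
      rw [Gam]; ring
    rw [← e] at h
    refine h.congr' ?_
    filter_upwards [eventually_gt_atTop 0] with A hA
    rw [log_div_sqrt hσ hA, upperBound, Function.comp_apply]
    field_simp
    ring
  have hlog : Tendsto (fun A : ℝ => Real.log (A / √(2 * Real.pi * Real.exp 1 * σ ^ 2)))
      atTop atTop :=
    Real.tendsto_log_atTop.comp (tendsto_id.atTop_div_const (by positivity))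
  -- `ENNReal.ofReal` truncates at zero, so nonnegativity is needed to recover the real upper bound.
  have hupTop : ∀ᶠ A in atTop, 0 ≤ upperBound σ α₁ α₂ l A := by
    have := (hup.add_atTop hlog).eventually_ge_atTop 0
    simpa using this
  refine tendsto_of_tendsto_of_tendsto_of_le_of_le' hlow hup ?_ ?_
  · filter_upwards [eventually_gt_atTop 0] with A hA
    gcongr
    exact (ENNReal.ofReal_le_iff_le_toReal (capacity_ne_top α₁ α₂ hσ hA)).1 (le_capacity hσ hl hA)
  · filter_upwards [eventually_gt_atTop 0, hupTop] with A hA hA0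
    gcongr
    exact ENNReal.toReal_le_of_le_ofReal hA0
      (capacity_le α₁ α₂ hσ hl.fst_nonneg hl.snd_nonneg hA)

/-! ### Activity of the constraints -/

theorem HasHighSNRLimit.tendsto_sub {σ α₁ α₂ β₁ β₂ L M : ℝ} (h : HasHighSNRLimit σ α₁ α₂ L)
    (h' : HasHighSNRLimit σ β₁ β₂ M) :
    Tendsto (fun A : ℝ => (capacity σ α₁ α₂ A).toReal - (capacity σ β₁ β₂ A).toReal)
      atTop (𝓝 (L - M)) := by
  simpa only [sub_sub_sub_cancel_right] using Tendsto.sub h h'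

/-- Since `mean 1 l < 1` and `l.1 = 0`, the same `l` satisfies the conditions with `α₁ = 1`, and the
two values of `Γ` agree. -/
theorem KKT.firstMomentInactive {σ α₁ α₂ : ℝ} (hσ : 0 < σ) {l : ℝ × ℝ} (hl : KKT α₁ α₂ l)
    (h : l.1 = 0) : FirstMomentInactive σ α₁ α₂ := by
  have hl' : KKT 1 α₂ l := ⟨hl.fst_nonneg, hl.snd_nonneg, (mean_one_lt_one l).le,
    hl.mean_two_le, by rw [h, zero_mul], hl.snd_slack⟩
  have := (hl'.hasHighSNRLimit hσ).tendsto_sub (hl.hasHighSNRLimit hσ)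
  simpa [FirstMomentInactive, Gam, h] using this

theorem KKT.secondMomentInactive {σ α₁ α₂ : ℝ} (hσ : 0 < σ) {l : ℝ × ℝ} (hl : KKT α₁ α₂ l)
    (h : l.2 = 0) : SecondMomentInactive σ α₁ α₂ := by
  have hl' : KKT α₁ 1 l := ⟨hl.fst_nonneg, hl.snd_nonneg, hl.mean_one_le,
    (mean_two_lt_one l).le, hl.fst_slack, by rw [h, zero_mul]⟩
  have := (hl'.hasHighSNRLimit hσ).tendsto_sub (hl.hasHighSNRLimit hσ)
  simpa [SecondMomentInactive, Gam, h] using this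

theorem KKT.mean_one_eq {α₁ α₂ : ℝ} {l : ℝ × ℝ} (hl : KKT α₁ α₂ l) (h : 0 < l.1) :
    mean 1 l = α₁ :=
  (sub_eq_zero.1 ((mul_eq_zero.1 hl.fst_slack).resolve_left h.ne')).symm

theorem KKT.mean_two_eq {α₁ α₂ : ℝ} {l : ℝ × ℝ} (hl : KKT α₁ α₂ l) (h : 0 < l.2) :
    mean 2 l = α₂ :=
  (sub_eq_zero.1 ((mul_eq_zero.1 hl.snd_slack).resolve_left h.ne')).symm

theorem KKT.fst_eq_zero {α₂ : ℝ} {l : ℝ × ℝ} (hl : KKT 1 α₂ l) : l.1 = 0 :=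
  (mul_eq_zero.1 hl.fst_slack).resolve_right (sub_pos.2 (mean_one_lt_one l)).ne'

theorem KKT.snd_eq_zero {α₁ : ℝ} {l : ℝ × ℝ} (hl : KKT α₁ 1 l) : l.2 = 0 :=
  (mul_eq_zero.1 hl.snd_slack).resolve_right (sub_pos.2 (mean_two_lt_one l)).ne'

/-- The optimum `m` of the relaxed problem has `m.1 = 0`, so its value is also a value of the
original `Γ`. It differs from `l`, and strict minimality leaves a positive gap between the limits.
-/
theorem KKT.firstMomentActive {σ α₁ α₂ : ℝ} (hσ : 0 < σ) (hα₂ : 0 < α₂) {l : ℝ × ℝ}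
    (hl : KKT α₁ α₂ l) (h : 0 < l.1) : ¬ FirstMomentInactive σ α₁ α₂ := by
  intro hin
  obtain ⟨m, hm⟩ := exists_KKT one_pos hα₂
  have hm0 := hm.fst_eq_zero
  have hlim := tendsto_nhds_unique hin
    ((hm.hasHighSNRLimit hσ).tendsto_sub (hl.hasHighSNRLimit hσ))
  have hne : m ≠ l := by
    rintro rfl
    exact h.ne' hm0
  have := hl.isUniqueMinimizer.2.2 m hm.fst_nonneg hm.snd_nonneg hne
  have e : Gam α₁ α₂ m = Gam 1 α₂ m := by simp [Gam, hm0]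
  linarith

theorem KKT.secondMomentActive {σ α₁ α₂ : ℝ} (hσ : 0 < σ) (hα₁ : 0 < α₁) {l : ℝ × ℝ}
    (hl : KKT α₁ α₂ l) (h : 0 < l.2) : ¬ SecondMomentInactive σ α₁ α₂ := by
  intro hin
  obtain ⟨m, hm⟩ := exists_KKT hα₁ one_pos
  have hm0 := hm.snd_eq_zero
  have hlim := tendsto_nhds_unique hin
    ((hm.hasHighSNRLimit hσ).tendsto_sub (hl.hasHighSNRLimit hσ))
  have hne : m ≠ l := by
    rintro rfl
    exact h.ne' hm0
  have := hl.isUniqueMinimizer.2.2 m hm.fst_nonneg hm.snd_nonneg hne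
  have e : Gam α₁ α₂ m = Gam α₁ 1 m := by simp [Gam, hm0]
  linarith

/-! ### One active constraint -/

theorem eq_of_mean_one_eq {a b : ℝ} (h : mean 1 (a, 0) = mean 1 (b, 0)) : a = b := by
  by_contra hab
  have := mean_strictAnti (l := (b, 0)) (m := (a, 0)) (by simpa using hab)
  simp [h] at this

theorem eq_of_mean_two_eq {a b : ℝ} (h : mean 2 (0, a) = mean 2 (0, b)) : a = b := by
  by_contra hab
  have := mean_strictAnti (l := (0, b)) (m := (0, a)) (by simpa using hab)
  simp [h] at this

theorem mean_one_lt_half {a : ℝ} (ha : 0 < a) : mean 1 (a, 0) < 1 / 2 := by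
  have := mean_strictAnti (l := (0, 0)) (m := (a, 0)) (by simpa using ha.ne')
  simp only [sub_zero, zero_mul, add_zero, mean_one_zero] at this
  linarith [neg_of_mul_neg_right this ha.le]

theorem mean_two_lt_third {a : ℝ} (ha : 0 < a) : mean 2 (0, a) < 1 / 3 := by
  have := mean_strictAnti (l := (0, 0)) (m := (0, a)) (by simpa using ha.ne')
  simp only [sub_zero, zero_mul, zero_add, mean_two_zero] at this
  linarith [neg_of_mul_neg_right this ha.le]

/-- Setting the other parameter to `1` forces the second multiplier to vanish, so solvability
follows from `exists_KKT`; a zero first multiplier would have mean `1 / 2 > α₁`. -/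
theorem exists_firstEq {α₁ : ℝ} (hα₁ : 0 < α₁) (h : α₁ < 1 / 2) :
    ∃ l : ℝ, 0 < l ∧ mean 1 (l, 0) = α₁ := by
  obtain ⟨⟨a, b⟩, hl⟩ := exists_KKT hα₁ one_pos
  obtain rfl : b = 0 := hl.snd_eq_zero
  have ha : 0 < a := by
    refine hl.fst_nonneg.lt_of_ne fun h0 => ?_
    obtain rfl : a = 0 := h0.symm
    have := hl.mean_one_le
    rw [mean_one_zero] at this
    linarith
  exact ⟨a, ha, hl.mean_one_eq ha⟩

theorem exists_secondEq {α₂ : ℝ} (hα₂ : 0 < α₂) (h : α₂ < 1 / 3) :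
    ∃ l : ℝ, 0 < l ∧ mean 2 (0, l) = α₂ := by
  obtain ⟨⟨a, b⟩, hl⟩ := exists_KKT one_pos hα₂
  obtain rfl : a = 0 := hl.fst_eq_zero
  have hb : 0 < b := by
    refine hl.snd_nonneg.lt_of_ne fun h0 => ?_
    obtain rfl : b = 0 := h0.symm
    have := hl.mean_two_le
    rw [mean_two_zero] at this
    linarith
  exact ⟨b, hb, hl.mean_two_eq hb⟩

end MomentChannel

end

theorem theorem1 (σ α₁ α₂ : ℝ) (hσ : 0 < σ) (hα₁ : 0 < α₁) (hα₂ : 0 < α₂) :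
    -- the capacity is finite, and the dual function is strictly convex
    (∀ A : ℝ, 0 < A → MomentChannel.capacity σ α₁ α₂ A ≠ ⊤) ∧
    StrictConvexOn ℝ Set.univ (MomentChannel.Gam α₁ α₂) ∧
    -- neither constraint is active
    (1 / 2 ≤ α₁ ∧ 1 / 3 ≤ α₂ →
      MomentChannel.FirstMomentInactive σ α₁ α₂ ∧
      MomentChannel.SecondMomentInactive σ α₁ α₂ ∧
      MomentChannel.IsUniqueMinimizer α₁ α₂ (0, 0) ∧
      MomentChannel.HasHighSNRLimit σ α₁ α₂ 0) ∧
    -- only the first-moment constraint is active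
    (α₁ < 1 / 2 →
      ∃ l : ℝ, 0 < l ∧ MomentChannel.FirstEq α₁ l ∧
        (∀ m : ℝ, m ≠ 0 → MomentChannel.FirstEq α₁ m → m = l) ∧
        (MomentChannel.FirstSlack α₂ l →
          ¬ MomentChannel.FirstMomentInactive σ α₁ α₂ ∧
          MomentChannel.SecondMomentInactive σ α₁ α₂ ∧
          MomentChannel.IsUniqueMinimizer α₁ α₂ (l, 0) ∧
          MomentChannel.HasHighSNRLimit σ α₁ α₂
            (Real.log (MomentChannel.zeta₀ l 0) + l * α₁))) ∧
    -- only the second-moment constraint is active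
    (α₂ < 1 / 3 →
      ∃ l : ℝ, 0 < l ∧ MomentChannel.SecondEq α₂ l ∧
        (∀ m : ℝ, 0 < m → MomentChannel.SecondEq α₂ m → m = l) ∧
        (MomentChannel.SecondSlack α₁ l →
          MomentChannel.FirstMomentInactive σ α₁ α₂ ∧
          ¬ MomentChannel.SecondMomentInactive σ α₁ α₂ ∧
          MomentChannel.IsUniqueMinimizer α₁ α₂ (0, l) ∧
          MomentChannel.HasHighSNRLimit σ α₁ α₂
            (Real.log (MomentChannel.zeta₀ 0 l) + l * α₂))) ∧
    -- in all remaining cases both constraints are active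
    (¬ (1 / 2 ≤ α₁ ∧ 1 / 3 ≤ α₂) →
      ¬ (α₁ < 1 / 2 ∧
        ∃ l : ℝ, 0 < l ∧ MomentChannel.FirstEq α₁ l ∧ MomentChannel.FirstSlack α₂ l) →
      ¬ (α₂ < 1 / 3 ∧
        ∃ l : ℝ, 0 < l ∧ MomentChannel.SecondEq α₂ l ∧ MomentChannel.SecondSlack α₁ l) →
      ¬ MomentChannel.FirstMomentInactive σ α₁ α₂ ∧
      ¬ MomentChannel.SecondMomentInactive σ α₁ α₂ ∧
      ∃ l₁ l₂ : ℝ, 0 < l₁ ∧ 0 < l₂ ∧ MomentChannel.BothEq α₁ α₂ l₁ l₂ ∧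
        (∀ m₁ m₂ : ℝ, 0 < m₁ → 0 < m₂ → MomentChannel.BothEq α₁ α₂ m₁ m₂ →
          m₁ = l₁ ∧ m₂ = l₂) ∧
        MomentChannel.IsUniqueMinimizer α₁ α₂ (l₁, l₂) ∧
        MomentChannel.HasHighSNRLimit σ α₁ α₂
          (Real.log (MomentChannel.zeta₀ l₁ l₂) + l₁ * α₁ + l₂ * α₂)) := by
  open MomentChannel in
  refine ⟨fun A hA => capacity_ne_top α₁ α₂ hσ hA, strictConvexOn_Gam α₁ α₂, ?_, ?_, ?_, ?_⟩
  · rintro ⟨h1, h2⟩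
    have hk : KKT α₁ α₂ (0, 0) := ⟨le_rfl, le_rfl, mean_one_zero.trans_le h1,
      mean_two_zero.trans_le h2, zero_mul _, zero_mul _⟩
    have h0 : Gam α₁ α₂ (0, 0) = 0 := by simp [Gam, zeta₀]
    exact ⟨hk.firstMomentInactive hσ rfl, hk.secondMomentInactive hσ rfl, hk.isUniqueMinimizer,
      h0 ▸ hk.hasHighSNRLimit hσ⟩
  · intro h
    obtain ⟨l, hl, he⟩ := exists_firstEq hα₁ h
    refine ⟨l, hl, (firstEq_iff hl.ne').2 he, fun m hm hm' =>
      eq_of_mean_one_eq (((firstEq_iff hm).1 hm').trans he.symm), fun hs => ?_⟩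
    have hk : KKT α₁ α₂ (l, 0) := ⟨hl.le, le_rfl, he.le, (firstSlack_iff hl.ne').1 hs,
      by rw [he, sub_self, mul_zero], zero_mul _⟩
    have h0 : Gam α₁ α₂ (l, 0) = Real.log (zeta₀ l 0) + l * α₁ := by simp [Gam]
    exact ⟨hk.firstMomentActive hσ hα₂ hl, hk.secondMomentInactive hσ rfl, hk.isUniqueMinimizer,
      h0 ▸ hk.hasHighSNRLimit hσ⟩
  · intro h
    obtain ⟨l, hl, he⟩ := exists_secondEq hα₂ h
    refine ⟨l, hl, (secondEq_iff hl).2 he, fun m hm hm' =>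
      eq_of_mean_two_eq (((secondEq_iff hm).1 hm').trans he.symm), fun hs => ?_⟩
    have hk : KKT α₁ α₂ (0, l) := ⟨le_rfl, hl.le, (secondSlack_iff hl).1 hs, he.le,
      zero_mul _, by rw [he, sub_self, mul_zero]⟩
    have h0 : Gam α₁ α₂ (0, l) = Real.log (zeta₀ 0 l) + l * α₂ := by simp [Gam]
    exact ⟨hk.firstMomentInactive hσ rfl, hk.secondMomentActive hσ hα₁ hl, hk.isUniqueMinimizer,
      h0 ▸ hk.hasHighSNRLimit hσ⟩
  · intro h1 h2 h3
    obtain ⟨⟨a, b⟩, hk⟩ := exists_KKT hα₁ hα₂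
    -- Each pattern with a vanishing multiplier lands in one of the three excluded cases; strict
    -- decrease of the means along the axes supplies `α₁ < 1 / 2` or `α₂ < 1 / 3`.
    have hpos : 0 < a ∧ 0 < b := by
      rcases hk.fst_nonneg.eq_or_lt with ha | ha <;> rcases hk.snd_nonneg.eq_or_lt with hb | hb
      · obtain rfl : a = 0 := ha.symm
        obtain rfl : b = 0 := hb.symm
        exact absurd ⟨mean_one_zero.symm.trans_le hk.mean_one_le,
          mean_two_zero.symm.trans_le hk.mean_two_le⟩ h1
      · obtain rfl : a = 0 := ha.symm
        have he := hk.mean_two_eq hb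
        exact absurd ⟨he ▸ mean_two_lt_third hb, b, hb, (secondEq_iff hb).2 he,
          (secondSlack_iff hb).2 hk.mean_one_le⟩ h3
      · obtain rfl : b = 0 := hb.symm
        have he := hk.mean_one_eq ha
        exact absurd ⟨he ▸ mean_one_lt_half ha, a, ha, (firstEq_iff ha.ne').2 he,
          (firstSlack_iff ha.ne').2 hk.mean_two_le⟩ h2
      · exact ⟨ha, hb⟩
    obtain ⟨ha, hb⟩ := hpos
    have he1 := hk.mean_one_eq ha
    have he2 := hk.mean_two_eq hb
    refine ⟨hk.firstMomentActive hσ hα₂ ha, hk.secondMomentActive hσ hα₁ hb, a, b, ha, hb,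
      (bothEq_iff hb).2 ⟨he1, he2⟩, fun m₁ m₂ _ hm₂ hm => ?_, hk.isUniqueMinimizer,
      hk.hasHighSNRLimit hσ⟩
    obtain ⟨hm1, hm2⟩ := (bothEq_iff hm₂).1 hm
    exact Prod.mk.inj (eq_of_mean_eq (hm1.trans he1.symm) (hm2.trans he2.symm))
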